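/- **Setting.** Let $T>0$, $H:\mathbb R\times\mathbb R\to\mathbb R$, $v_0:\mathbb R\to\mathbb R$, and consider $$v_t+H(x,v_x)=0\ \text{ on } (0,T)\times\mathbb R,\qquad v(0,\cdot)=v_0. \tag{1}$$ Assume * (A1) $v_0$ is Lipschitz continuous; moreover $v_0$ is bounded; * (A2) for some $C\ge 0$ and all $x,y,p,q$: $|H(y,p)-H(x,p)|\le C(1+|p|)|y-x|$ and $|H(x,q)-H(x,p)|\le C(1+|x|)|q-p|$. Let $v$ be the continuous viscosity solution of (1) on $[0,T]\times\mathbb R$. *Schemes.* For $\Delta x>0$ and $m\ge1$ put $D^{m,\pm}u(x)=\pm\frac{u(x\pm m\Delta x)-u(x)}{\Delta x}$ and $D^\pm=D^{1,\pm}$. For $\tau,\Delta x,\varepsilon>0$ let $$S^M(u)(x)=u(x)-\tau\,h^M(x,D^-u(x),D^+u(x)),\qquad S^A(u)(x)=u(x)-\tau\,h^A\big(x,(D^{m,-}u(x))_{1\le m\le r},(D^{m,+}u(x))_{1\le m\le r}\big),$$ $$S^F(u)=S^M(u)+\varepsilon\tau F\Big(\frac{S^A(u)-S^M(u)}{\varepsilon\tau}\Big),$$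 where $r\in\mathbb N$, $F:\mathbb R\to\mathbb R$, and $h^A$ may also depend on $(\tau,\Delta x)$. Let $\mathcal G$ be any set of pairs of steps $(\tau,\Delta x)\in(0,\infty)^2$ such that * (A3) $h^M$ is Lipschitz continuous; $h^M(x,p,p)=H(x,p)$ for all $x,p$; and for $(\tau,\Delta x)\in\mathcal G$ the scheme $S^M$ is monotone: $u\le w$ implies $S^M(u)\le S^M(w)$. Given $N\ge1$, $\tau=T/N$ and $(\tau,\Delta x)\in\mathcal G$, let $t_n=n\tau$, $x_j=j\Delta x$, $u^0_j=v_0(x_j)$, $u^{n+1}_j=S^F(u^n)_j$, $v^n_j=v(t_n,x_j)$ ($0\le n\le N$, $j\in\mathbb Z$). For a scheme $S$ with time step $\tau$ let $$\mathcal E_S(w)(t,x)=\Big|\frac{w(t+\tau,x)-S(w(t,\cdot))(x)}{\tau}-\big(w_t(t,x)+H(x,w_x(t,x))\big)\Big| .$$ For a rectangle $R=[a,b]\times[c,d]$ ($a<b$, $c<d$) and $w$ of class $C^{\ell+1}$ in a neighbourhood of $R$, a number $C\ge0$ is called a *consistency constant of order $\ell$* of $S$ for $w$ on $R$ if for all $(\tau,\Delta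 x)\in\mathcal G$ $$\mathcal E_S(w)(t,x)\le C\big(\tau^\ell\|\partial_t^{\ell+1}w\|_{\infty,R}+\Delta x^\ell\|\partial_x^{\ell+1}w\|_{\infty,R}\big)$$ at every $(t,x)$ with $[t,t+\tau]\times[x-r\Delta x,x+r\Delta x]\subset R$ ($r$ the stencil radius of $S$; $r=1$ for $S^M$). * (A4) (with order $k\ge2$; only used in (iii)) For each $(\tau,\Delta x)\in\mathcal G$ the function $h^A$ is Lipschitz continuous, and for all $1\le\ell\le k$, every rectangle $R$ and every $w$ of class $C^{\ell+1}$ near $R$ with $w_t+H(x,w_x)=0$ on $R$, $S^A$ has a consistency constant of order $\ell$ for $w$ on $R$. **Theorem.** (i) For every $c_0>0$ there is a constant $C$, independent of $\Delta x,\tau,\varepsilon,F$ and $S^A$, such that if $|F|\le1$ and $0<\varepsilon\le c_0\sqrt{\Delta x}$, then $|u^n_j-v^n_j|\le C\sqrt{\Delta x}$ for all $0\le n\le N$ and $j\in\mathbb Z$. (ii) If $v\in C^2([0,T]\times\mathbb R)$ with $v_{tt}$ and $v_{xx}$ bounded, then for every $c_0>0$ there is a constant $C$, independent of $\Delta x,\tau,\varepsilon,F$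 and $S^A$, such that if $|F|\le1$ and $0<\varepsilon\le c_0\Delta x$, then $|u^n_j-v^n_j|\le C\Delta x$ for all $0\le n\le N$ and $j\in\mathbb Z$. (iii) There is a constant $C_M$ which is a consistency constant of order $1$ of $S^M$ for all $w$ of class $C^2$ near $R$ and all rectangles $R$. Let $S^A$ satisfy (A4) for some $k\ge2$, let $1\le\ell\le k$, and let $(t,x)$ be an interior point of a rectangle $R\subset(0,T)\times\mathbb R$ near which $v$ is of class $C^{\ell+1}$. Then there are $\delta>0$ and $C$ with the following property. Let $C_M$ and $C_{A,1}$ be any consistency constants of order $1$ of $S^M$ and of $S^A$ for $v$ on $R$, let $F(y)=y$ for $|y|\le1$, and let $\varepsilon>0$ satisfy $$(C_{A,1}+C_M)\big(\|v_{tt}\|_{\infty,R}\,\tau+\|v_{xx}\|_{\infty,R}\,\Delta x\big)\le\varepsilon .$$ If $\tau$, $\Delta x$, $|t_n-t|$, $|x_j-x|$ are all less than $\delta$, then $$S^F(v^n)_j=S^A(v^n)_j\qquad\text{and}\qquad \mathcal E_{S^F}(v)(t_n,x_j)=\mathcal E_{S^A}(v)(t_n,x_j)\le C\,\Delta x^\ell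 .$$ -/

import Mathlib

open Set

noncomputable section

namespace FilteredHJ

/-- `(A1)`: the initial datum is Lipschitz continuous. -/
def AssumptionA1 (v0 : ℝ → ℝ) : Prop :=
  ∃ L0 : ℝ, 0 < L0 ∧ ∀ x y : ℝ, |v0 x - v0 y| ≤ L0 * |x - y|

/-- `(A2)`: the structure conditions on the Hamiltonian. -/
def AssumptionA2 (H : ℝ → ℝ → ℝ) : Prop :=
  ∃ C : ℝ, 0 ≤ C ∧
    (∀ x y p : ℝ, |H y p - H x p| ≤ C * (1 + |p|) * |y - x|) ∧
    (∀ x p q : ℝ, |H x q - H x p| ≤ C * (1 + |x|) * |q - p|)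

/-- Time derivative at `(t, x)`. -/
def dt (w : ℝ → ℝ → ℝ) (t x : ℝ) : ℝ := deriv (fun s => w s x) t

/-- Space derivative at `(t, x)`. -/
def dx (w : ℝ → ℝ → ℝ) (t x : ℝ) : ℝ := deriv (fun y => w t y) x

/-- Continuous viscosity solution on `[0,T] × ℝ` of the Cauchy problem
`v_t + H(x, v_x) = 0`, `v(0, ·) = v0`. Test functions are of class `C¹` near the point. -/
structure IsViscositySolution (H : ℝ → ℝ → ℝ) (v0 : ℝ → ℝ) (T : ℝ) (v : ℝ → ℝ → ℝ) : Prop where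
  continuousOn : ContinuousOn (fun z : ℝ × ℝ => v z.1 z.2) (Icc 0 T ×ˢ univ)
  initial : ∀ x, v 0 x = v0 x
  subsolution : ∀ (φ : ℝ → ℝ → ℝ) (t x : ℝ), t ∈ Ioo 0 T →
    ContDiffAt ℝ 1 (fun z : ℝ × ℝ => φ z.1 z.2) (t, x) →
    IsLocalMax (fun z : ℝ × ℝ => v z.1 z.2 - φ z.1 z.2) (t, x) →
    dt φ t x + H x (dx φ t x) ≤ 0
  supersolution : ∀ (φ : ℝ → ℝ → ℝ) (t x : ℝ), t ∈ Ioo 0 T →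
    ContDiffAt ℝ 1 (fun z : ℝ × ℝ => φ z.1 z.2) (t, x) →
    IsLocalMin (fun z : ℝ × ℝ => v z.1 z.2 - φ z.1 z.2) (t, x) →
    0 ≤ dt φ t x + H x (dx φ t x)

/-- `D^{m,+} u(x) = (u(x + m Δx) - u(x)) / Δx`. -/
def dPlus (Δx : ℝ) (m : ℕ) (u : ℝ → ℝ) (x : ℝ) : ℝ := (u (x + m * Δx) - u x) / Δx

/-- `D^{m,-} u(x) = -(u(x - m Δx) - u(x)) / Δx`. -/
def dMinus (Δx : ℝ) (m : ℕ) (u : ℝ → ℝ) (x : ℝ) : ℝ := -((u (x - m * Δx) - u x) / Δx)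

/-- The finite difference scheme `S^M` with numerical Hamiltonian `hM`. -/
def schemeM (hM : ℝ → ℝ → ℝ → ℝ) (τ Δx : ℝ) (u : ℝ → ℝ) (x : ℝ) : ℝ :=
  u x - τ * hM x (dMinus Δx 1 u x) (dPlus Δx 1 u x)

/-- The scheme `S^A` with stencil radius `r` and numerical Hamiltonian `hA`, which may depend on
the steps `τ`, `Δx` (its first two arguments). The last two arguments of `hA` are
`(D^{m,-} u(x))` and `(D^{m,+} u(x))`, `m = 1, …, r`. -/
def schemeA {r : ℕ} (hA : ℝ → ℝ → ℝ → (Fin r → ℝ) → (Fin r → ℝ) → ℝ) (τ Δx : ℝ)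
    (u : ℝ → ℝ) (x : ℝ) : ℝ :=
  u x - τ * hA τ Δx x (fun m => dMinus Δx (m.val + 1) u x) (fun m => dPlus Δx (m.val + 1) u x)

/-- The filtered scheme `S^F = S^M + ε τ F((S^A - S^M) / (ε τ))`. -/
def schemeF {r : ℕ} (hM : ℝ → ℝ → ℝ → ℝ) (hA : ℝ → ℝ → ℝ → (Fin r → ℝ) → (Fin r → ℝ) → ℝ)
    (F : ℝ → ℝ) (ε τ Δx : ℝ) (u : ℝ → ℝ) (x : ℝ) : ℝ :=
  schemeM hM τ Δx u x +
    ε * τ * F ((schemeA hA τ Δx u x - schemeM hM τ Δx u x) / (ε * τ))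

/-- The iterates `u^0 = v0`, `u^{n+1} = S^F(u^n)`. The value at a node `x_j = j Δx` only involves
values at nodes, so that `u^n_j = filteredSol … n (j Δx)` is the scheme on the mesh. -/
def filteredSol {r : ℕ} (hM : ℝ → ℝ → ℝ → ℝ)
    (hA : ℝ → ℝ → ℝ → (Fin r → ℝ) → (Fin r → ℝ) → ℝ)
    (F : ℝ → ℝ) (ε τ Δx : ℝ) (v0 : ℝ → ℝ) : ℕ → ℝ → ℝ
  | 0 => v0
  | n + 1 => schemeF hM hA F ε τ Δx (filteredSol hM hA F ε τ Δx v0 n)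

/-- `(A3)` for the steps `(τ, Δx)` in `G`: Lipschitz continuity, consistency, monotonicity. -/
structure AssumptionA3 (H : ℝ → ℝ → ℝ) (hM : ℝ → ℝ → ℝ → ℝ) (G : Set (ℝ × ℝ)) : Prop where
  lipschitz : ∃ K, LipschitzWith K (fun z : ℝ × ℝ × ℝ => hM z.1 z.2.1 z.2.2)
  consistent : ∀ x p : ℝ, hM x p p = H x p
  monotone : ∀ τ Δx : ℝ, (τ, Δx) ∈ G → ∀ u w : ℝ → ℝ, (∀ x, u x ≤ w x) →
    ∀ x, schemeM hM τ Δx u x ≤ schemeM hM τ Δx w x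

/-- Consistency error
`|(w(t+τ,x) - S(w(t,·))(x)) / τ - (w_t(t,x) + H(x, w_x(t,x)))|` of a scheme `S` with step `τ`. -/
def consErr (H : ℝ → ℝ → ℝ) (S : (ℝ → ℝ) → ℝ → ℝ) (τ : ℝ) (w : ℝ → ℝ → ℝ) (t x : ℝ) : ℝ :=
  |(w (t + τ) x - S (w t) x) / τ - (dt w t x + H x (dx w t x))|

/-- `‖∂_t^m w‖_∞` on the rectangle `[a,b] × [c,d]`. -/
def normDt (m : ℕ) (w : ℝ → ℝ → ℝ) (a b c d : ℝ) : ℝ :=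
  sSup ((fun z : ℝ × ℝ => |iteratedDeriv m (fun s => w s z.2) z.1|) '' (Icc a b ×ˢ Icc c d))

/-- `‖∂_x^m w‖_∞` on the rectangle `[a,b] × [c,d]`. -/
def normDx (m : ℕ) (w : ℝ → ℝ → ℝ) (a b c d : ℝ) : ℝ :=
  sSup ((fun z : ℝ × ℝ => |iteratedDeriv m (fun y => w z.1 y) z.2|) '' (Icc a b ×ˢ Icc c d))

/-- `w` is of class `C^m` on a neighbourhood of the rectangle `[a,b] × [c,d]`. -/
def SmoothOnRect (m : ℕ) (w : ℝ → ℝ → ℝ) (a b c d : ℝ) : Prop :=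
  ∀ z ∈ Icc a b ×ˢ Icc c d, ContDiffAt ℝ m (fun z : ℝ × ℝ => w z.1 z.2) z

/-- `C` is a constant of consistency of order `ℓ`, on the rectangle `[a,b] × [c,d]` and for the
function `w`, of the family of schemes `S τ Δx`, `(τ, Δx) ∈ G`, with stencil radius `r`:
the consistency error is at most `C (τ^ℓ ‖∂_t^{ℓ+1} w‖_∞ + Δx^ℓ ‖∂_x^{ℓ+1} w‖_∞)` at all
points whose space-time stencil lies in the rectangle. -/
def IsConsistencyConst (H : ℝ → ℝ → ℝ) (G : Set (ℝ × ℝ)) (S : ℝ → ℝ → (ℝ → ℝ) → ℝ → ℝ) (r : ℕ)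
    (ℓ : ℕ) (w : ℝ → ℝ → ℝ) (a b c d : ℝ) (C : ℝ) : Prop :=
  0 ≤ C ∧ ∀ τ Δx t x : ℝ, (τ, Δx) ∈ G →
    a ≤ t → t + τ ≤ b → c ≤ x - r * Δx → x + r * Δx ≤ d →
    consErr H (S τ Δx) τ w t x ≤
      C * (τ ^ ℓ * normDt (ℓ + 1) w a b c d + Δx ^ ℓ * normDx (ℓ + 1) w a b c d)

/-- `(A4)` with order `k`, for the steps `(τ, Δx)` in `G`: Lipschitz continuity of `hA`, and
consistency of every order `ℓ = 1, …, k` for the `C^{ℓ+1}` solutions of `w_t + H(x, w_x) = 0`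
on rectangles. -/
structure AssumptionA4 {r : ℕ} (H : ℝ → ℝ → ℝ)
    (hA : ℝ → ℝ → ℝ → (Fin r → ℝ) → (Fin r → ℝ) → ℝ) (G : Set (ℝ × ℝ)) (k : ℕ) : Prop where
  lipschitz : ∀ τ Δx : ℝ, (τ, Δx) ∈ G → ∃ K, LipschitzWith K
    (fun z : ℝ × (Fin r → ℝ) × (Fin r → ℝ) => hA τ Δx z.1 z.2.1 z.2.2)
  consistent : ∀ ℓ : ℕ, 1 ≤ ℓ → ℓ ≤ k → ∀ (w : ℝ → ℝ → ℝ) (a b c d : ℝ), a < b → c < d →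
    SmoothOnRect (ℓ + 1) w a b c d →
    (∀ t ∈ Icc a b, ∀ x ∈ Icc c d, dt w t x + H x (dx w t x) = 0) →
    ∃ C : ℝ, IsConsistencyConst H G (schemeA hA) r ℓ w a b c d C

end FilteredHJ

end

namespace FilteredHJ

/-! The filter changes `S^M` by at most ετ per step, so for (i) and (ii) the iterates are an
ετ-perturbation of a monotone scheme, whatever `S^A` is.

For (i), doubling of variables is replaced by an induction on n for the bound v(t_n, x) ≤ u^n(y) +
α_n (x-y)²/(2δ) + error, valid for all x and y, with α_n = 1 + K t_n (`le_scheme_add_quadratic`).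
Monotonicity of `S^M`, applied in y to a parabola, advances u and leaves a term τ H(y, α(x-y)/δ). An
explicit smooth supersolution in x absorbs this term while advancing v (`le_quadratic_step`). The
defect per step is τ(ε + O(δ + Δx/δ + τ/δ)), which δ = √Δx balances. Taking x = y gives the upper
bound, and the reflection v ↦ -v the lower one (`exists_error_bound`).

Powers of τ are traded for powers of Δx by a dichotomy (`indep_or_exists_cfl`): either h^M ignores
its gradient variables, and then v = v₀ - tH(x,0) and `S^M` is exact on v, or monotonicity forces τ
≤ λΔx.

(ii) is first order consistency combined with the sup-norm stability of a monotone scheme. In (iii),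
consistency of both schemes puts the argument of F in [-1,1], where F is the identity. -/

/-! ### Comparison with smooth supersolutions. -/

/-- A function of class `C¹` which is a classical supersolution on a strip, and which dominates a
continuous viscosity subsolution initially, dominates it at the final time. No growth condition is
needed since `H` is Lipschitz continuous in the gradient variable. -/
theorem le_of_contDiff_supersolution {H : ℝ → ℝ → ℝ} {K T t0 t1 : ℝ} {v φ : ℝ → ℝ → ℝ}
    (hK : 0 ≤ K) (hH : ∀ x p q, |H x p - H x q| ≤ K * |p - q|)
    (hcont : ContinuousOn (fun z : ℝ × ℝ => v z.1 z.2) (Icc 0 T ×ˢ univ))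
    (hsub : ∀ (φ : ℝ → ℝ → ℝ) (t x : ℝ), t ∈ Ioo 0 T →
      ContDiffAt ℝ 1 (fun z : ℝ × ℝ => φ z.1 z.2) (t, x) →
      IsLocalMax (fun z : ℝ × ℝ => v z.1 z.2 - φ z.1 z.2) (t, x) →
      dt φ t x + H x (dx φ t x) ≤ 0)
    (ht0 : 0 ≤ t0) (ht01 : t0 < t1) (ht1 : t1 ≤ T)
    (hφ : ContDiff ℝ 1 (fun z : ℝ × ℝ => φ z.1 z.2))
    (hsuper : ∀ t ∈ Ioo t0 t1, ∀ x, 0 ≤ dt φ t x + H x (dx φ t x))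
    (hinit : ∀ x, v t0 x ≤ φ t0 x) (x0 : ℝ) : v t1 x0 ≤ φ t1 x0 := by
  by_contra hcon
  push Not at hcon
  have hIcc : Icc t0 t1 ⊆ Icc 0 T := Icc_subset_Icc ht0 ht1
  -- a point of the open strip where `φ < v`
  obtain ⟨t, ht, hlt⟩ : ∃ t ∈ Ioo t0 t1, φ t x0 < v t x0 := by
    have h1 : ContinuousWithinAt (fun s => v s x0 - φ s x0) (Ioo t0 t1) t1 := by
      have h2 : ContinuousOn (fun s : ℝ => v s x0) (Icc t0 t1) :=
        hcont.comp (f := fun s : ℝ => (s, x0)) (by fun_prop)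
          (fun s hs => ⟨hIcc hs, mem_univ _⟩)
      have h3 : Continuous (fun s : ℝ => φ s x0) :=
        hφ.continuous.comp (f := fun s : ℝ => (s, x0)) (by fun_prop)
      exact (((h2.sub h3.continuousOn) t1 (right_mem_Icc.2 ht01.le)).mono Ioo_subset_Icc_self)
    have h4 : ∀ᶠ s in nhdsWithin t1 (Ioo t0 t1), 0 < v s x0 - φ s x0 :=
      h1.eventually (lt_mem_nhds (sub_pos.2 hcon))
    have h5 : (nhdsWithin t1 (Ioo t0 t1)).NeBot := by
      rw [← mem_closure_iff_nhdsWithin_neBot, closure_Ioo ht01.ne]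
      exact right_mem_Icc.2 ht01.le
    obtain ⟨s, hs, hs'⟩ := (h4.and self_mem_nhdsWithin).exists
    exact ⟨s, hs', by linarith⟩
  set γ := v t x0 - φ t x0 with hγ
  have hγ0 : 0 < γ := by linarith
  -- The sets {S ≤ R} are smoothed backward cones: they shrink in time at speed at least K, the
  -- propagation speed of the equation.
  set S : ℝ × ℝ → ℝ := fun z => K * z.1 + √(1 + (z.2 - x0) ^ 2) with hS
  have hScont : Continuous S := by fun_prop
  set R := K * t1 + 2 with hR
  set σ := γ * (t1 - t) / 3 with hσ
  have htt : 0 < t1 - t := by linarith [ht.2]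
  have hσ0 : 0 < σ := by positivity
  set ε := γ / 3 with hε
  have hε0 : 0 < ε := by positivity
  -- A barrier that blows up at time t1 and on the boundary S = R of the cone. The weights σ, ε and
  -- the radius R make each term at most γ/3 at (t, x0), so v - φ - b is still positive there.
  set b : ℝ × ℝ → ℝ := fun z => σ / (t1 - z.1) + ε / (R - S z) with hb
  have habs : ∀ z : ℝ × ℝ, |z.2 - x0| ≤ √(1 + (z.2 - x0) ^ 2) := fun z => by
    apply Real.abs_le_sqrt; linarith
  have hbig : IsCompact (Icc t0 t1 ×ˢ Icc (x0 - R) (x0 + R)) := isCompact_Icc.prod isCompact_Icc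
  have hdc : ContinuousOn (fun z : ℝ × ℝ => v z.1 z.2 - φ z.1 z.2) (Icc t0 t1 ×ˢ univ) :=
    (hcont.mono (prod_mono hIcc le_rfl)).sub hφ.continuous.continuousOn
  obtain ⟨M, hM⟩ := hbig.bddAbove_image (hdc.mono (prod_mono le_rfl (subset_univ _)))
  have hM' : ∀ z : ℝ × ℝ, z.1 ∈ Icc t0 t1 → S z ≤ R → v z.1 z.2 - φ z.1 z.2 ≤ M := by
    intro z hz hzR
    apply hM
    refine ⟨z, ⟨hz, ?_⟩, rfl⟩
    have h1 := habs z
    have h2 : 0 ≤ K * z.1 := mul_nonneg hK (ht0.trans hz.1)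
    have h3 : |z.2 - x0| ≤ R := by simp only [hS] at hzR; linarith
    rw [abs_le] at h3
    exact ⟨by linarith [h3.1], by linarith [h3.2]⟩
  have hSt : S (t, x0) = K * t + 1 := by simp [hS]
  have hRS : 1 ≤ R - S (t, x0) := by
    rw [hSt, hR]; nlinarith [ht.2, mul_nonneg hK htt.le]
  set Q := max M (γ + 1) with hQ
  have hQ0 : 0 < Q := lt_of_lt_of_le (by linarith) (le_max_right _ _)
  have hQγ : γ + 1 ≤ Q := le_max_right _ _
  have hMQ : M ≤ Q := le_max_left _ _
  -- On the final and lateral boundaries of C one barrier term equals Q ≥ M ≥ v - φ, and at t0 the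
  -- initial inequality applies. A positive maximum over C is therefore interior.
  set C : Set (ℝ × ℝ) := {z | z.1 ∈ Icc t0 (t1 - σ / Q) ∧ S z ≤ R - ε / Q} with hC
  have hσQ : 0 < σ / Q := by positivity
  have hεQ : 0 < ε / Q := by positivity
  have hCsub : C ⊆ Icc t0 t1 ×ˢ Icc (x0 - R) (x0 + R) := by
    rintro z ⟨hz1, hz2⟩
    have hz : z.1 ∈ Icc t0 t1 := ⟨hz1.1, by linarith [hz1.2]⟩
    refine ⟨hz, ?_⟩
    have h1 := habs z
    have h2 : 0 ≤ K * z.1 := mul_nonneg hK (ht0.trans hz.1)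
    have h3 : |z.2 - x0| ≤ R := by simp only [hS] at hz2; linarith
    rw [abs_le] at h3
    exact ⟨by linarith [h3.1], by linarith [h3.2]⟩
  have hCcomp : IsCompact C := by
    refine hbig.of_isClosed_subset ?_ hCsub
    exact (isClosed_Icc.preimage continuous_fst).inter (isClosed_le hScont continuous_const)
  have htC : (t, x0) ∈ C := by
    refine ⟨⟨ht.1.le, ?_⟩, ?_⟩
    · have : σ / Q ≤ t1 - t := by
        rw [div_le_iff₀ hQ0, hσ]; nlinarith
      simp only; linarith
    · have : ε / Q ≤ 1 := by rw [div_le_iff₀ hQ0]; linarith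
      linarith
  have hbc : ContinuousOn b C := by
    intro z hz
    have h1 : t1 - z.1 ≠ 0 := by have := hz.1.2; linarith
    have h2 : R - S z ≠ 0 := by have := hz.2; linarith
    apply ContinuousAt.continuousWithinAt
    have h3 : ContinuousAt (fun w : ℝ × ℝ => t1 - w.1) z := by fun_prop
    have h4 : ContinuousAt (fun w => R - S w) z := by fun_prop
    exact (continuousAt_const.div h3 h1).add (continuousAt_const.div h4 h2)
  obtain ⟨z, hzC, hzmax⟩ := hCcomp.exists_isMaxOn ⟨_, htC⟩
    ((hdc.mono (hCsub.trans (prod_mono le_rfl (subset_univ _)))).sub hbc)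
  have hzpos : 0 < v z.1 z.2 - φ z.1 z.2 - b z := by
    refine lt_of_lt_of_le ?_ (hzmax htC)
    change 0 < γ - (σ / (t1 - t) + ε / (R - S (t, x0)))
    have h1 : σ / (t1 - t) = γ / 3 := by rw [hσ]; field_simp
    have h2 : ε / (R - S (t, x0)) ≤ ε := div_le_self hε0.le hRS
    linarith
  have ha : 0 < t1 - z.1 := by linarith [hzC.1.2]
  have hc : 0 < R - S z := by linarith [hzC.2]
  have hb1 : 0 < σ / (t1 - z.1) := by positivity
  have hb2 : 0 < ε / (R - S z) := by positivity
  have hbz : b z = σ / (t1 - z.1) + ε / (R - S z) := rfl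
  have hzQ := hM' z ⟨hzC.1.1, by linarith⟩ (by linarith)
  have hz0 : t0 < z.1 := by
    rcases hzC.1.1.lt_or_eq with h | h
    · exact h
    · have := hinit z.2
      rw [h] at this
      linarith
  have hz1 : z.1 < t1 - σ / Q := by
    rcases hzC.1.2.lt_or_eq with h | h
    · exact h
    · have : σ / (t1 - z.1) = Q := by
        rw [h, sub_sub_cancel, div_div_cancel₀ hσ0.ne']
      linarith
  have hz2 : S z < R - ε / Q := by
    rcases hzC.2.lt_or_eq with h | h
    · exact h
    · have : ε / (R - S z) = Q := by
        rw [h, sub_sub_cancel, div_div_cancel₀ hε0.ne']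
      linarith
  have hnear : C ∈ nhds z := by
    have h1 : ∀ᶠ w : ℝ × ℝ in nhds z, t0 < w.1 :=
      continuous_fst.continuousAt.eventually (lt_mem_nhds hz0)
    have h2 : ∀ᶠ w : ℝ × ℝ in nhds z, w.1 < t1 - σ / Q :=
      continuous_fst.continuousAt.eventually (gt_mem_nhds hz1)
    have h3 : ∀ᶠ w : ℝ × ℝ in nhds z, S w < R - ε / Q :=
      hScont.continuousAt.eventually (gt_mem_nhds hz2)
    filter_upwards [h1, h2, h3] with w hw1 hw2 hw3
    exact ⟨⟨hw1.le, hw2.le⟩, hw3.le⟩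
  have hroot : 0 < 1 + (z.2 - x0) ^ 2 := by positivity
  have hbdiff : ContDiffAt ℝ 1 b z := by
    have hs : ContDiffAt ℝ 1 S z := by
      refine ContDiffAt.add (by fun_prop) (ContDiffAt.sqrt (by fun_prop) hroot.ne')
    have h3 : ContDiffAt ℝ 1 (fun w : ℝ × ℝ => t1 - w.1) z := by fun_prop
    have h4 : ContDiffAt ℝ 1 (fun w => R - S w) z := contDiffAt_const.sub hs
    exact (contDiffAt_const.div h3 ha.ne').add (contDiffAt_const.div h4 hc.ne')
  have hmax := hzmax.isLocalMax hnear
  have key := hsub (fun s y => φ s y + b (s, y)) z.1 z.2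
    ⟨by linarith, by linarith⟩ (hφ.contDiffAt.add hbdiff) (by
      refine hmax.congr ?_ 
      exact Filter.Eventually.of_forall fun w => sub_sub _ _ _)
  have hdφt : HasDerivAt (fun s => φ s z.2) (dt φ z.1 z.2) z.1 := by
    have h : Differentiable ℝ (fun s => φ s z.2) :=
      (hφ.differentiable one_ne_zero).comp (f := fun s : ℝ => (s, z.2)) (by fun_prop)
    exact (h z.1).hasDerivAt
  have hdφx : HasDerivAt (fun y => φ z.1 y) (dx φ z.1 z.2) z.2 := by
    have h : Differentiable ℝ (fun y => φ z.1 y) :=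
      (hφ.differentiable one_ne_zero).comp (f := fun y : ℝ => (z.1, y)) (by fun_prop)
    exact (h z.2).hasDerivAt
  have hbt : HasDerivAt (fun s => b (s, z.2))
      (σ / (t1 - z.1) ^ 2 + ε * K / (R - S z) ^ 2) z.1 := by
    have h1 : HasDerivAt (fun s : ℝ => t1 - s) (-1) z.1 := by
      simpa using (hasDerivAt_id z.1).const_sub t1
    have h2 : HasDerivAt (fun s : ℝ => R - S (s, z.2)) (-K) z.1 := by
      simpa [hS] using (((hasDerivAt_id z.1).const_mul K).add_const
        (√(1 + (z.2 - x0) ^ 2))).const_sub R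
    refine (((hasDerivAt_const z.1 σ).fun_div h1 ha.ne').fun_add
      ((hasDerivAt_const z.1 ε).fun_div h2 hc.ne')).congr_deriv ?_
    ring
  have hbx : HasDerivAt (fun y => b (z.1, y))
      (ε / (R - S z) ^ 2 * ((z.2 - x0) / √(1 + (z.2 - x0) ^ 2))) z.2 := by
    have h0 : HasDerivAt (fun y : ℝ => 1 + (y - x0) ^ 2) (2 * (z.2 - x0)) z.2 := by
      simpa using (((hasDerivAt_id z.2).sub_const x0).pow 2).const_add 1
    have h2 : HasDerivAt (fun y : ℝ => R - S (z.1, y))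
        (-(2 * (z.2 - x0) / (2 * √(1 + (z.2 - x0) ^ 2)))) z.2 :=
      ((h0.sqrt hroot.ne').const_add (K * z.1)).const_sub R
    refine ((hasDerivAt_const z.2 (σ / (t1 - z.1))).fun_add
      ((hasDerivAt_const z.2 ε).fun_div h2 hc.ne')).congr_deriv ?_
    have : √(1 + (z.2 - x0) ^ 2) ≠ 0 := (Real.sqrt_pos.2 hroot).ne'
    field_simp
    ring
  have e1 : dt (fun s y => φ s y + b (s, y)) z.1 z.2 =
      dt φ z.1 z.2 + (σ / (t1 - z.1) ^ 2 + ε * K / (R - S z) ^ 2) := (hdφt.add hbt).deriv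
  have e2 : dx (fun s y => φ s y + b (s, y)) z.1 z.2 =
      dx φ z.1 z.2 + ε / (R - S z) ^ 2 * ((z.2 - x0) / √(1 + (z.2 - x0) ^ 2)) :=
    (hdφx.add hbx).deriv
  rw [e1, e2] at key
  -- K times the slope of b is at most the cone part of its time derivative. The surplus σ/(t1 - s)²
  -- makes φ + b a strict supersolution, which contradicts the test inequality at the maximum.
  have hlip := (abs_le.1 (hH z.2 (dx φ z.1 z.2 + ε / (R - S z) ^ 2 *
    ((z.2 - x0) / √(1 + (z.2 - x0) ^ 2))) (dx φ z.1 z.2))).1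
  have hsm : |dx φ z.1 z.2 + ε / (R - S z) ^ 2 * ((z.2 - x0) / √(1 + (z.2 - x0) ^ 2)) -
      dx φ z.1 z.2| ≤ ε / (R - S z) ^ 2 := by
    rw [add_sub_cancel_left, abs_mul, abs_of_nonneg (by positivity : 0 ≤ ε / (R - S z) ^ 2),
      abs_div, abs_of_nonneg (Real.sqrt_nonneg _)]
    exact mul_le_of_le_one_right (by positivity) (div_le_one_of_le₀ (habs z) (Real.sqrt_nonneg _))
  have h3 := mul_le_mul_of_nonneg_left hsm hK
  have h4 := hsuper z.1 ⟨hz0, by linarith⟩ z.2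
  have h5 : 0 < σ / (t1 - z.1) ^ 2 := by positivity
  have h6 : ε * K / (R - S z) ^ 2 = K * (ε / (R - S z) ^ 2) := by ring
  linarith

/-! ### Propagation of a quadratic bound over one time step. -/

/-- A Lipschitz function has uniform `C¹` approximations with the same Lipschitz constant. -/
theorem exists_contDiff_approx {f : ℝ → ℝ} {K δ : ℝ} (hδ : 0 < δ)
    (hf : ∀ p q, |f p - f q| ≤ K * |p - q|) :
    ∃ g : ℝ → ℝ, ContDiff ℝ 1 g ∧ (∀ p, |g p - f p| ≤ K * δ) ∧ ∀ p, |deriv g p| ≤ K := by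
  have hK : 0 ≤ K := by
    have := (abs_nonneg _).trans (hf 1 0)
    simpa using this
  have hc : Continuous f := by
    have : LipschitzWith K.toNNReal f := LipschitzWith.of_dist_le_mul fun p q => by
      rw [Real.coe_toNNReal _ hK]; exact hf p q
    exact this.continuous
  -- The approximation is the moving average of f over [p, p + δ]; its derivative is a difference
  -- quotient of f.
  set I : ℝ → ℝ := fun p => ∫ s in (0 : ℝ)..p, f s with hI
  have hId : ∀ p, HasDerivAt I (f p) p := fun p =>
    intervalIntegral.integral_hasDerivAt_right (hc.intervalIntegrable _ _)
      (hc.stronglyMeasurableAtFilter _ _) hc.continuousAt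
  have hgd : ∀ p, HasDerivAt (fun p => (I (p + δ) - I p) / δ) ((f (p + δ) - f p) / δ) p :=
    fun p => (((hId (p + δ)).comp_add_const p δ).sub (hId p)).div_const δ
  refine ⟨fun p => (I (p + δ) - I p) / δ, ?_, ?_, ?_⟩
  · rw [contDiff_one_iff_deriv]
    refine ⟨fun p => (hgd p).differentiableAt, ?_⟩
    have : deriv (fun p => (I (p + δ) - I p) / δ) = fun p => (f (p + δ) - f p) / δ :=
      funext fun p => (hgd p).deriv
    rw [this]
    fun_prop
  · intro p
    obtain ⟨c, hc1, hc2⟩ := exists_hasDerivAt_eq_slope I f (by linarith : p < p + δ)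
      (fun s _ => (hId s).continuousAt.continuousWithinAt) (fun s _ => hId s)
    have : (I (p + δ) - I p) / δ = f c := by rw [hc2]; congr 1; ring
    simp only [this]
    refine (hf c p).trans (mul_le_mul_of_nonneg_left ?_ hK)
    rw [abs_of_pos (by linarith [hc1.1])]
    linarith [hc1.2]
  · intro p
    rw [(hgd p).deriv, abs_div, abs_of_pos hδ, div_le_iff₀ hδ]
    have := hf (p + δ) p
    rwa [add_sub_cancel_left, abs_of_pos hδ] at this

/-- Propagation over one time step of a quadratic upper bound of a viscosity subsolution. -/
theorem le_quadratic_step {H : ℝ → ℝ → ℝ} {K T t0 τ δ α A : ℝ} {v : ℝ → ℝ → ℝ}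
    (hK : 0 ≤ K) (hH : ∀ x y p q, |H x p - H y q| ≤ K * (|x - y| + |p - q|))
    (hcont : ContinuousOn (fun z : ℝ × ℝ => v z.1 z.2) (Icc 0 T ×ˢ univ))
    (hsub : ∀ (φ : ℝ → ℝ → ℝ) (t x : ℝ), t ∈ Ioo 0 T →
      ContDiffAt ℝ 1 (fun z : ℝ × ℝ => φ z.1 z.2) (t, x) →
      IsLocalMax (fun z : ℝ × ℝ => v z.1 z.2 - φ z.1 z.2) (t, x) →
      dt φ t x + H x (dx φ t x) ≤ 0)
    (ht0 : 0 ≤ t0) (hτ : 0 < τ) (ht1 : t0 + τ ≤ T) (hδ : 0 < δ) (hα : 0 ≤ α) (y : ℝ)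
    (hinit : ∀ x, v t0 x ≤ A + α * ((x - y) ^ 2 / (2 * δ)) + τ * H y (α * (x - y) / δ)) (x : ℝ) :
    v (t0 + τ) x ≤ A + (α + K * τ) * ((x - y) ^ 2 / (2 * δ)) +
      τ * (3 * K * δ + K ^ 3 * τ ^ 2 / δ + K ^ 2 * τ * α / δ) := by
  obtain ⟨g, hg1, hg2, hg3⟩ := exists_contDiff_approx (f := H y) (K := K) hδ
    (fun p q => by simpa using hH y y p q)
  -- One Kδ pays for replacing H(y,·) by g, the other for Young's inequality on K|x-y|. The
  -- remaining terms bound the effect of the gradient of φ moving away from α(x-y)/δ.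
  set c := 2 * K * δ + K ^ 3 * τ ^ 2 / δ + K ^ 2 * τ * α / δ with hc
  -- The term (t0 + τ - t) g starts as the given τH, up to mollification, and vanishes at the final
  -- time; its time derivative -g cancels H. The growing coefficient of the parabola supplies
  -- K(x-y)²/(2δ) in φ_t.
  set φ : ℝ → ℝ → ℝ := fun t x => A + τ * (K * δ) +
    (α + K * (t - t0)) * ((x - y) ^ 2 / (2 * δ)) + (t0 + τ - t) * g (α * (x - y) / δ) +
    (t - t0) * c with hφ
  have hφC : ContDiff ℝ 1 (fun z : ℝ × ℝ => φ z.1 z.2) := by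
    simp only [hφ]
    have : ContDiff ℝ 1 (fun z : ℝ × ℝ => g (α * (z.2 - y) / δ)) :=
      hg1.comp (f := fun z : ℝ × ℝ => α * (z.2 - y) / δ) (by fun_prop)
    fun_prop
  have hgd : ∀ p, HasDerivAt g (deriv g p) p := fun p =>
    (hg1.differentiable one_ne_zero p).hasDerivAt
  have hφt : ∀ t x, dt φ t x = K * ((x - y) ^ 2 / (2 * δ)) - g (α * (x - y) / δ) + c := by
    intro t x
    have h1 : HasDerivAt (fun s : ℝ => s - t0) 1 t := (hasDerivAt_id t).sub_const t0
    have h2 : HasDerivAt (fun s : ℝ => t0 + τ - s) (-1) t := (hasDerivAt_id t).const_sub _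
    refine HasDerivAt.deriv (f := fun s => φ s x) ?_
    refine ((((((h1.const_mul K).const_add α).mul_const ((x - y) ^ 2 / (2 * δ))).const_add
      (A + τ * (K * δ))).fun_add (h2.mul_const (g (α * (x - y) / δ)))).fun_add
      (h1.mul_const c)).congr_deriv ?_
    ring
  have hφx : ∀ t x, dx φ t x = (α + K * (t - t0)) * ((x - y) / δ) +
      (t0 + τ - t) * (deriv g (α * (x - y) / δ) * (α / δ)) := by
    intro t x
    have h1 : HasDerivAt (fun s : ℝ => s - y) 1 x := (hasDerivAt_id x).sub_const y
    have h2 : HasDerivAt (fun s : ℝ => g (α * (s - y) / δ))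
        (deriv g (α * (x - y) / δ) * (α * 1 / δ)) x :=
      (hgd (α * (x - y) / δ)).comp (h := fun s : ℝ => α * (s - y) / δ) x
        ((h1.const_mul α).div_const δ)
    refine HasDerivAt.deriv (f := fun s => φ t s) ?_
    refine ((((((h1.fun_pow 2).div_const (2 * δ)).const_mul (α + K * (t - t0))).const_add
      (A + τ * (K * δ))).fun_add (h2.const_mul (t0 + τ - t))).add_const
      ((t - t0) * c)).congr_deriv ?_
    field_simp
    ring
  have key := le_of_contDiff_supersolution (t0 := t0) (t1 := t0 + τ) hK
    (fun x p q => by simpa using hH x x p q) hcont hsub ht0 (by linarith) ht1 hφC ?_ ?_ x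
  · simp only [hφ] at key
    have e : A + (α + K * τ) * ((x - y) ^ 2 / (2 * δ)) +
      τ * (3 * K * δ + K ^ 3 * τ ^ 2 / δ + K ^ 2 * τ * α / δ) = A + τ * (K * δ) +
      (α + K * (t0 + τ - t0)) * ((x - y) ^ 2 / (2 * δ)) +
      (t0 + τ - (t0 + τ)) * g (α * (x - y) / δ) + (t0 + τ - t0) * c := by
      rw [hc]; ring
    rw [e]; exact key
  · intro t ht x
    rw [hφt, hφx]
    set z := x - y with hz
    set p := α * z / δ with hp
    set q := (α + K * (t - t0)) * (z / δ) + (t0 + τ - t) * (deriv g p * (α / δ)) with hq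
    have h1 := (abs_le.1 (hH x y q p)).1
    have h2 := (abs_le.1 (hg2 p)).2
    have h3 : |q - p| ≤ K * τ * (|z| / δ) + τ * (K * (α / δ)) := by
      have e : q - p = K * (t - t0) * (z / δ) + (t0 + τ - t) * (deriv g p * (α / δ)) := by
        rw [hq, hp]; ring
      rw [e]
      refine (abs_add_le _ _).trans (add_le_add ?_ ?_)
      · rw [abs_mul, abs_div, abs_of_pos hδ, abs_of_nonneg (mul_nonneg hK (by linarith [ht.1]))]
        exact mul_le_mul_of_nonneg_right
          (mul_le_mul_of_nonneg_left (by linarith [ht.2]) hK) (by positivity)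
      · rw [abs_mul, abs_mul, abs_of_nonneg (by positivity : 0 ≤ α / δ),
          abs_of_nonneg (by linarith [ht.2] : 0 ≤ t0 + τ - t)]
        have := hg3 p
        gcongr
        linarith [ht.1]
    have h4 := mul_le_mul_of_nonneg_left h3 hK
    -- The supply K z²/(2δ) is split in halves: one absorbs the dependence of H on x, the other the
    -- growth of the slope of the parabola.
    have h5 : K * |z| ≤ K * (z ^ 2 / (4 * δ)) + K * δ := by
      rw [← mul_add]
      refine mul_le_mul_of_nonneg_left ?_ hK
      rw [← sub_nonneg, ← sq_abs z]
      have : |z| ^ 2 / (4 * δ) + δ - |z| = (|z| - 2 * δ) ^ 2 / (4 * δ) := by field_simp; ring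
      rw [this]; positivity
    have h6 : K * (K * τ * (|z| / δ)) ≤ K * (z ^ 2 / (4 * δ)) + K ^ 3 * τ ^ 2 / δ := by
      have : K * (z ^ 2 / (4 * δ)) + K ^ 3 * τ ^ 2 / δ - K * (K * τ * (|z| / δ)) =
          K * ((|z| - 2 * (K * τ)) ^ 2 / (4 * δ)) := by
        rw [← sq_abs z]; field_simp; ring
      rw [← sub_nonneg, this]; positivity
    have h7 : K * (z ^ 2 / (2 * δ)) = K * (z ^ 2 / (4 * δ)) + K * (z ^ 2 / (4 * δ)) := by
      field_simp; ring
    have h8 : K * (τ * (K * (α / δ))) = K ^ 2 * τ * α / δ := by ring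
    have h9 : K * (|x - y| + |q - p|) = K * |z| + K * |q - p| := by rw [mul_add]
    rw [h9] at h1
    rw [h7]
    linarith
  · intro x
    have h1 := (abs_le.1 (hg2 (α * (x - y) / δ))).1
    have h2 := hinit x
    have h3 := mul_le_mul_of_nonneg_left h1 hτ.le
    simp only [hφ]
    have e : A + τ * (K * δ) + (α + K * (t0 - t0)) * ((x - y) ^ 2 / (2 * δ)) +
      (t0 + τ - t0) * g (α * (x - y) / δ) + (t0 - t0) * c = A + α * ((x - y) ^ 2 / (2 * δ)) +
      τ * (K * δ) + τ * g (α * (x - y) / δ) := by ring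
    rw [e]
    linarith

/-! ### Square-root error estimate for perturbed monotone schemes. -/

/-- The scheme `S^M` commutes with the addition of constants. -/
theorem schemeM_add_const (hM : ℝ → ℝ → ℝ → ℝ) (τ Δx : ℝ) (u : ℝ → ℝ) (c x : ℝ) :
    schemeM hM τ Δx (fun y => u y + c) x = schemeM hM τ Δx u x + c := by
  simp only [schemeM, dMinus, dPlus, add_sub_add_right_eq_sub]
  ring

theorem AssumptionA3.exists_lipschitz {H : ℝ → ℝ → ℝ} {hM : ℝ → ℝ → ℝ → ℝ} {G : Set (ℝ × ℝ)}
    (h : AssumptionA3 H hM G) : ∃ K : ℝ, 0 ≤ K ∧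
      ∀ x y p p' q q', |hM x p q - hM y p' q'| ≤ K * max |x - y| (max |p - p'| |q - q'|) := by
  obtain ⟨K, hK⟩ := h.lipschitz
  exact ⟨K, K.2, fun x y p p' q q' => hK.dist_le_mul (x, p, q) (y, p', q')⟩

/-- Consistency identifies H with h^M on the diagonal, so H inherits a global Lipschitz bound in
both variables, stronger than the growth allowed by (A2). -/
theorem AssumptionA3.abs_hamiltonian_sub_le {H : ℝ → ℝ → ℝ} {hM : ℝ → ℝ → ℝ → ℝ}
    {G : Set (ℝ × ℝ)} (h : AssumptionA3 H hM G) {K : ℝ} (hK : 0 ≤ K)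
    (hlip : ∀ x y p p' q q', |hM x p q - hM y p' q'| ≤ K * max |x - y| (max |p - p'| |q - q'|))
    (x y p q : ℝ) : |H x p - H y q| ≤ K * (|x - y| + |p - q|) := by
  rw [← h.consistent, ← h.consistent]
  refine (hlip _ _ _ _ _ _).trans (mul_le_mul_of_nonneg_left ?_ hK)
  rw [max_self]
  exact max_le (by linarith [abs_nonneg (p - q)]) (by linarith [abs_nonneg (x - y)])

/-- Upper bound of a viscosity subsolution by a perturbed supersolution of a monotone scheme,
with a quadratic penalization of width `δ`. -/
theorem le_scheme_add_quadratic {H : ℝ → ℝ → ℝ} {hM : ℝ → ℝ → ℝ → ℝ} {G : Set (ℝ × ℝ)}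
    (hA3 : AssumptionA3 H hM G) {K L0 T τ Δx ε δ : ℝ} {v0 : ℝ → ℝ} {v : ℝ → ℝ → ℝ}
    (hK : 0 ≤ K)
    (hlip : ∀ x y p p' q q', |hM x p q - hM y p' q'| ≤ K * max |x - y| (max |p - p'| |q - q'|))
    (hv0 : ∀ x y, |v0 x - v0 y| ≤ L0 * |x - y|)
    (hv : IsViscositySolution H v0 T v)
    (hG : (τ, Δx) ∈ G) (hτ : 0 < τ) (hΔx : 0 < Δx) (hδ : 0 < δ) {u : ℕ → ℝ → ℝ}
    (hu0 : u 0 = v0)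
    (hu : ∀ n x, schemeM hM τ Δx (u n) x - ε * τ ≤ u (n + 1) x) (n : ℕ) (hn : n * τ ≤ T)
    (x y : ℝ) :
    v (n * τ) x ≤ u n y + (1 + K * (n * τ)) * ((x - y) ^ 2 / (2 * δ)) + L0 ^ 2 * δ / 2 +
      n * τ * (ε + 3 * K * δ + K ^ 3 * τ ^ 2 / δ + K ^ 2 * τ * (1 + K * T) / δ +
        K * (1 + K * T) * Δx / (2 * δ)) := by
  have hH := hA3.abs_hamiltonian_sub_le hK hlip
  set η := ε + 3 * K * δ + K ^ 3 * τ ^ 2 / δ + K ^ 2 * τ * (1 + K * T) / δ +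
        K * (1 + K * T) * Δx / (2 * δ) with hη
  induction n generalizing x y with
  | zero =>
    simp only [Nat.cast_zero, zero_mul, mul_zero, add_zero, one_mul]
    rw [hv.initial, hu0]
    have h1 := (abs_le.1 (hv0 x y)).2
    have h2 : (x - y) ^ 2 / (2 * δ) + L0 ^ 2 * δ / 2 - L0 * |x - y| =
        (|x - y| - L0 * δ) ^ 2 / (2 * δ) := by
      rw [← sq_abs (x - y)]; field_simp; ring
    have h3 : 0 ≤ (|x - y| - L0 * δ) ^ 2 / (2 * δ) := by positivity
    linarith
  | succ n ih =>
    have hn' : n * τ + τ ≤ T := by push_cast at hn; linarith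
    have hnτ : 0 ≤ n * τ := by positivity
    set α := 1 + K * (n * τ) with hα
    have hα0 : 0 ≤ α := by positivity
    have hαT : α ≤ 1 + K * T := by
      have := mul_le_mul_of_nonneg_left (by linarith : n * τ ≤ T) hK
      linarith
    set B := L0 ^ 2 * δ / 2 + n * τ * η with hB
    set c1 := K * α * Δx / (2 * δ) with hc1
    have hinit : ∀ x, v (n * τ) x ≤ (u (n + 1) y + ε * τ + B + τ * c1) +
        α * ((x - y) ^ 2 / (2 * δ)) + τ * H y (α * (x - y) / δ) := by
      intro x
      -- With x frozen, the induction hypothesis places a parabola in y below u^n; one step of the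
      -- scheme preserves this order.
      have hmon := hA3.monotone τ Δx hG
        (fun y => v (n * τ) x - α * ((x - y) ^ 2 / (2 * δ)) - B) (u n)
        (fun y => by have := ih (by linarith) x y; linarith) y
      have h1 := hu n y
      set p := α * (x - y) / δ with hp
      -- The one-sided differences of the parabola are p ± αΔx/(2δ), so replacing h^M by H(y, p)
      -- costs `c1`.
      have e : schemeM hM τ Δx (fun y => v (n * τ) x - α * ((x - y) ^ 2 / (2 * δ)) - B) y =
          v (n * τ) x - α * ((x - y) ^ 2 / (2 * δ)) - B -
            τ * hM y (p + α * Δx / (2 * δ)) (p - α * Δx / (2 * δ)) := by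
        simp only [schemeM, dMinus, dPlus, Nat.cast_one, one_mul]
        congr 3
        · rw [hp]; field_simp; ring
        · rw [hp]; field_simp; ring
      have h2 := (abs_le.1 (hlip y y (p + α * Δx / (2 * δ)) p (p - α * Δx / (2 * δ)) p)).2
      have e2 : max |y - y| (max |p + α * Δx / (2 * δ) - p| |p - α * Δx / (2 * δ) - p|) =
          α * Δx / (2 * δ) := by
        have h0 : 0 ≤ α * Δx / (2 * δ) := by positivity
        rw [add_sub_cancel_left, sub_sub_cancel_left, abs_neg, abs_of_nonneg h0, max_self, sub_self,
          abs_zero, max_eq_right h0]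
      rw [e2, hA3.consistent] at h2
      have h3 := mul_le_mul_of_nonneg_left h2 hτ.le
      have h4 : τ * (K * (α * Δx / (2 * δ))) = τ * c1 := by rw [hc1]; ring
      rw [e] at hmon
      linarith
    have key := le_quadratic_step hK hH hv.continuousOn hv.subsolution hnτ hτ hn' hδ hα0 y hinit x
    have e1 : ((n + 1 : ℕ) : ℝ) * τ = n * τ + τ := by push_cast; ring
    rw [e1]
    refine key.trans ?_
    have e2 : 1 + K * (n * τ + τ) = α + K * τ := by rw [hα]; ring
    rw [e2]
    have h5 : c1 ≤ K * (1 + K * T) * Δx / (2 * δ) := by rw [hc1]; gcongr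
    have h6 : K ^ 2 * τ * α / δ ≤ K ^ 2 * τ * (1 + K * T) / δ := by gcongr
    have h7 : τ * (ε + c1 + (3 * K * δ + K ^ 3 * τ ^ 2 / δ + K ^ 2 * τ * α / δ)) ≤ τ * η :=
      mul_le_mul_of_nonneg_left (by rw [hη]; linarith) hτ.le
    rw [hB]
    linarith

theorem dt_neg (w : ℝ → ℝ → ℝ) (t x : ℝ) : dt (fun s y => -w s y) t x = -dt w t x :=
  deriv.fun_neg

theorem dx_neg (w : ℝ → ℝ → ℝ) (t x : ℝ) : dx (fun s y => -w s y) t x = -dx w t x :=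
  deriv.fun_neg

/-- Reflection exchanges sub- and supersolutions; it turns the lower error bound into the upper one
for the reflected problem. -/
theorem IsViscositySolution.neg {H : ℝ → ℝ → ℝ} {v0 : ℝ → ℝ} {T : ℝ} {v : ℝ → ℝ → ℝ}
    (hv : IsViscositySolution H v0 T v) :
    IsViscositySolution (fun x p => -H x (-p)) (fun x => -v0 x) T (fun t x => -v t x) where
  continuousOn := hv.continuousOn.neg
  initial x := by rw [hv.initial]
  subsolution φ t x ht hφ hmax := by
    have := hv.supersolution (fun s y => -φ s y) t x ht hφ.neg
      (hmax.neg.congr (Filter.Eventually.of_forall fun w => by ring))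
    rw [dt_neg, dx_neg] at this
    linarith
  supersolution φ t x ht hφ hmin := by
    have := hv.subsolution (fun s y => -φ s y) t x ht hφ.neg
      (hmin.neg.congr (Filter.Eventually.of_forall fun w => by ring))
    rw [dt_neg, dx_neg] at this
    linarith

theorem schemeM_neg (hM : ℝ → ℝ → ℝ → ℝ) (τ Δx : ℝ) (u : ℝ → ℝ) (x : ℝ) :
    schemeM (fun x p q => -hM x (-p) (-q)) τ Δx (fun y => -u y) x = -schemeM hM τ Δx u x := by
  have e1 : -dMinus Δx 1 (fun y => -u y) x = dMinus Δx 1 u x := by simp only [dMinus]; ring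
  have e2 : -dPlus Δx 1 (fun y => -u y) x = dPlus Δx 1 u x := by simp only [dPlus]; ring
  simp only [schemeM, e1, e2]
  ring

theorem AssumptionA3.neg {H : ℝ → ℝ → ℝ} {hM : ℝ → ℝ → ℝ → ℝ} {G : Set (ℝ × ℝ)}
    (h : AssumptionA3 H hM G) :
    AssumptionA3 (fun x p => -H x (-p)) (fun x p q => -hM x (-p) (-q)) G where
  lipschitz := by
    obtain ⟨K, hK⟩ := h.lipschitz
    refine ⟨K, LipschitzWith.of_dist_le_mul fun z w => ?_⟩
    have := hK.dist_le_mul (z.1, -z.2.1, -z.2.2) (w.1, -w.2.1, -w.2.2)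
    simpa only [Prod.dist_eq, dist_neg_neg] using this
  consistent x p := by rw [h.consistent]
  monotone τ Δx hG u w huw x := by
    have := h.monotone τ Δx hG (fun y => -w y) (fun y => -u y) (fun y => neg_le_neg (huw y)) x
    have e1 := schemeM_neg hM τ Δx (fun y => -w y) x
    have e2 := schemeM_neg hM τ Δx (fun y => -u y) x
    simp only [neg_neg] at e1 e2
    rw [e1, e2]
    exact neg_le_neg this

/-- Error estimate for perturbations of a monotone scheme whose steps satisfy `τ ≤ λ Δx`. -/
theorem exists_error_bound {H : ℝ → ℝ → ℝ} {hM : ℝ → ℝ → ℝ → ℝ} {G : Set (ℝ × ℝ)}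
    (hA3 : AssumptionA3 H hM G) {T lam : ℝ} {v0 : ℝ → ℝ} {v : ℝ → ℝ → ℝ} (hT : 0 ≤ T)
    (hA1 : AssumptionA1 v0) (hv : IsViscositySolution H v0 T v)
    (hG : ∀ τ Δx : ℝ, (τ, Δx) ∈ G → 0 < τ ∧ 0 < Δx) (hlam : 0 ≤ lam)
    (hGlam : ∀ τ Δx : ℝ, (τ, Δx) ∈ G → τ ≤ lam * Δx) :
    ∃ C : ℝ, ∀ (τ Δx ε : ℝ) (u : ℕ → ℝ → ℝ), (τ, Δx) ∈ G → 0 ≤ ε → u 0 = v0 →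
      (∀ n x, |u (n + 1) x - schemeM hM τ Δx (u n) x| ≤ ε * τ) →
      ∀ n : ℕ, n * τ ≤ T → ∀ x, |u n x - v (n * τ) x| ≤ C * √Δx + T * ε := by
  obtain ⟨K, hK, hlip⟩ := hA3.exists_lipschitz
  obtain ⟨L0, -, hv0⟩ := hA1
  set C := L0 ^ 2 / 2 + T * (3 * K + K ^ 3 * T * lam + K ^ 2 * lam * (1 + K * T) +
    K * (1 + K * T) / 2) with hC
  refine ⟨C, ?_⟩
  intro τ Δx ε u hmem hε hu0 hu n hn x
  obtain ⟨hτ, hΔx⟩ := hG _ _ hmem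
  set δ := √Δx with hδ'
  have hδ : 0 < δ := Real.sqrt_pos.2 hΔx
  have hδ2 : Δx = δ * δ := (Real.mul_self_sqrt hΔx.le).symm
  have hτlam : τ ≤ lam * (δ * δ) := hδ2 ▸ hGlam _ _ hmem
  have bound : n * τ * (ε + 3 * K * δ + K ^ 3 * τ ^ 2 / δ + K ^ 2 * τ * (1 + K * T) / δ +
        K * (1 + K * T) * Δx / (2 * δ)) + L0 ^ 2 * δ / 2 ≤ C * δ + T * ε := by
    -- For n = 0 nothing gives τ ≤ T, which the estimate of τ²/δ needs; only the initial error is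
    -- present then.
    rcases Nat.eq_zero_or_pos n with rfl | hn0
    · simp only [Nat.cast_zero, zero_mul, zero_add]
      have : C * δ - L0 ^ 2 * δ / 2 = T * (3 * K + K ^ 3 * T * lam + K ^ 2 * lam * (1 + K * T) +
        K * (1 + K * T) / 2) * δ := by rw [hC]; ring
      have h2 : 0 ≤ T * (3 * K + K ^ 3 * T * lam + K ^ 2 * lam * (1 + K * T) +
        K * (1 + K * T) / 2) * δ := by positivity
      have h3 : 0 ≤ T * ε := by positivity
      linarith
    have hτT : τ ≤ T := by
      have : (1 : ℝ) ≤ n := by exact_mod_cast hn0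
      nlinarith
    have h1 : τ / δ ≤ lam * δ := by rw [div_le_iff₀ hδ]; linarith
    have h2 : K ^ 3 * τ ^ 2 / δ ≤ K ^ 3 * T * lam * δ := by
      have : K ^ 3 * τ ^ 2 / δ = K ^ 3 * (τ * (τ / δ)) := by ring
      rw [this, mul_assoc (K ^ 3) T, mul_assoc (K ^ 3)]
      refine mul_le_mul_of_nonneg_left ?_ (by positivity)
      rw [mul_assoc]
      exact mul_le_mul hτT h1 (by positivity) hT
    have h3 : K ^ 2 * τ * (1 + K * T) / δ ≤ K ^ 2 * lam * (1 + K * T) * δ := by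
      have e1 : K ^ 2 * τ * (1 + K * T) / δ = K ^ 2 * (1 + K * T) * (τ / δ) := by ring
      have e2 : K ^ 2 * lam * (1 + K * T) * δ = K ^ 2 * (1 + K * T) * (lam * δ) := by ring
      rw [e1, e2]
      exact mul_le_mul_of_nonneg_left h1 (by positivity)
    have h4 : K * (1 + K * T) * Δx / (2 * δ) = K * (1 + K * T) / 2 * δ := by
      rw [hδ2]; field_simp
    have h5 : n * τ * (ε + 3 * K * δ + K ^ 3 * τ ^ 2 / δ + K ^ 2 * τ * (1 + K * T) / δ +
        K * (1 + K * T) * Δx / (2 * δ)) ≤ T * (ε + 3 * K * δ + K ^ 3 * T * lam * δ +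
          K ^ 2 * lam * (1 + K * T) * δ + K * (1 + K * T) / 2 * δ) := by
      refine mul_le_mul hn ?_ (by positivity) hT
      rw [h4]; linarith
    refine (add_le_add_left h5 _).trans (le_of_eq ?_)
    rw [hC]; ring
  have up := le_scheme_add_quadratic (ε := ε) hA3 hK hlip hv0 hv hmem hτ hΔx hδ hu0
    (fun n x => by have := (abs_le.1 (hu n x)).1; linarith) n hn x x
  have lo := le_scheme_add_quadratic (ε := ε) hA3.neg (v0 := fun x => -v0 x) (u := fun n x => -u n x)
    hK (fun x y p p' q q' => by
      have := hlip y x (-p') (-p) (-q') (-q)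
      rw [abs_sub_comm x y]
      simpa only [neg_sub_neg] using this)
    (fun x y => by rw [neg_sub_neg, abs_sub_comm]; exact hv0 x y) hv.neg hmem hτ hΔx hδ
    (by simp only [hu0])
    (fun n x => by
      have := (abs_le.1 (hu n x)).2
      rw [schemeM_neg]; linarith) n hn x x
  rw [sub_self] at up lo
  simp only [ne_eq, OfNat.ofNat_ne_zero, not_false_eq_true, zero_pow, zero_div, mul_zero,
    add_zero] at up lo
  rw [abs_le]
  constructor <;> linarith

/-! ### The CFL dichotomy and gradient-independent Hamiltonians. -/

/-- A function constant on each side of x takes arbitrary independent values at the three nodes of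
the stencil. -/
theorem AssumptionA3.node_values_mono {H : ℝ → ℝ → ℝ} {hM : ℝ → ℝ → ℝ → ℝ} {G : Set (ℝ × ℝ)}
    (h : AssumptionA3 H hM G) {τ Δx : ℝ} (hG : (τ, Δx) ∈ G) (hΔx : 0 < Δx) (x : ℝ)
    {a b c a' b' c' : ℝ} (ha : a ≤ a') (hb : b ≤ b') (hc : c ≤ c') :
    a - τ * hM x ((a - b) / Δx) ((c - a) / Δx) ≤
      a' - τ * hM x ((a' - b') / Δx) ((c' - a') / Δx) := by
  have e : ∀ a b c : ℝ, schemeM hM τ Δx (fun s => if s = x then a else if s < x then b else c) x =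
      a - τ * hM x ((a - b) / Δx) ((c - a) / Δx) := by
    intro a b c
    have h1 : ¬ x + Δx < x := by linarith
    simp [schemeM, dMinus, dPlus, hΔx, hΔx.ne', h1, ← neg_div]
  rw [← e, ← e]
  refine h.monotone τ Δx hG _ _ (fun s => ?_) x
  split_ifs <;> assumption

/-- Either the numerical Hamiltonian does not depend on the gradient variables, or monotonicity
forces a CFL condition. -/
theorem AssumptionA3.indep_or_exists_cfl {H : ℝ → ℝ → ℝ} {hM : ℝ → ℝ → ℝ → ℝ} {G : Set (ℝ × ℝ)}
    (h : AssumptionA3 H hM G) (hG : ∀ τ Δx : ℝ, (τ, Δx) ∈ G → 0 < τ ∧ 0 < Δx) :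
    (∀ x p q, hM x p q = H x 0) ∨
      ∃ lam : ℝ, 0 ≤ lam ∧ ∀ τ Δx : ℝ, (τ, Δx) ∈ G → τ ≤ lam * Δx := by
  by_cases hc : ∀ x p q, hM x p q = H x 0
  · exact Or.inl hc
  right
  push Not at hc
  obtain ⟨x, p, q, hne⟩ := hc
  rw [← h.consistent] at hne
  set m := |p| + |q| with hm
  have hm0 : 0 ≤ m := by positivity
  have hd : 0 < |hM x p q - hM x 0 0| := abs_pos.2 (sub_ne_zero.2 hne)
  refine ⟨2 * m / |hM x p q - hM x 0 0|, by positivity, fun τ Δx hmem => ?_⟩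
  obtain ⟨hτ, hΔx⟩ := hG τ Δx hmem
  have mono : ∀ p q p' q', p' ≤ p → q ≤ q' → hM x p' q' ≤ hM x p q := by
    intro p q p' q' hp hq
    have := h.node_values_mono hmem hΔx x (le_refl (0 : ℝ))
      (neg_le_neg (mul_le_mul_of_nonneg_right hp hΔx.le)) (mul_le_mul_of_nonneg_right hq hΔx.le)
    simp only [sub_neg_eq_add, zero_add, sub_zero, mul_div_cancel_right₀ _ hΔx.ne'] at this
    exact le_of_mul_le_mul_left (by linarith) hτ
  -- With both neighbours at mΔx, raising the central value from 0 to 2mΔx turns the slopes (-m, m)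
  -- into (m, -m). Monotonicity bounds the resulting change of τ h^M by the rise 2mΔx.
  have shift : τ * (hM x m (-m) - hM x (-m) m) ≤ 2 * m * Δx := by
    have h1 := h.node_values_mono hmem hΔx x (by positivity : 0 ≤ 2 * m * Δx)
      (le_refl (m * Δx)) (le_refl (m * Δx))
    have e1 : (0 - m * Δx) / Δx = -m := by field_simp; ring
    have e2 : (m * Δx - 0) / Δx = m := by field_simp; ring
    have e3 : (2 * m * Δx - m * Δx) / Δx = m := by field_simp; ring
    have e4 : (m * Δx - 2 * m * Δx) / Δx = -m := by field_simp; ring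
    rw [e1, e2, e3, e4] at h1
    linarith
  have hp1 : -m ≤ p := by linarith [neg_abs_le p, abs_nonneg q]
  have hp2 : p ≤ m := by linarith [le_abs_self p, abs_nonneg q]
  have hq1 : -m ≤ q := by linarith [neg_abs_le q, abs_nonneg p]
  have hq2 : q ≤ m := by linarith [le_abs_self q, abs_nonneg p]
  have i1 := mono p q (-m) m hp1 hq2
  have i2 := mono m (-m) p q hp2 hq1
  have i3 := mono 0 0 (-m) m (by linarith) hm0
  have i4 := mono m (-m) 0 0 hm0 (by linarith)
  have i5 : |hM x p q - hM x 0 0| ≤ hM x m (-m) - hM x (-m) m := by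
    rw [abs_le]; constructor <;> linarith
  rw [div_mul_eq_mul_div, le_div_iff₀ hd]
  exact (mul_le_mul_of_nonneg_left i5 hτ.le).trans shift

/-- The viscosity solution when the Hamiltonian does not depend on the gradient. -/
theorem eq_sub_mul_of_indep {H : ℝ → ℝ → ℝ} {hM : ℝ → ℝ → ℝ → ℝ} {G : Set (ℝ × ℝ)}
    (hA3 : AssumptionA3 H hM G) (hind : ∀ x p q, hM x p q = H x 0) {T : ℝ} {v0 : ℝ → ℝ}
    {v : ℝ → ℝ → ℝ} (hA1 : AssumptionA1 v0) (hv : IsViscositySolution H v0 T v) {t : ℝ}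
    (ht : t ∈ Icc 0 T) (x : ℝ) : v t x = v0 x - t * H x 0 := by
  rcases ht.1.eq_or_lt with h0 | h0
  · rw [← h0, hv.initial]; ring
  -- Without gradient dependence `S^M` is monotone for all steps, so the error estimate may be used
  -- along τ = Δx, where λ = 1.
  have hA3' : AssumptionA3 H hM {z : ℝ × ℝ | z.1 = z.2 ∧ 0 < z.1} :=
    ⟨hA3.lipschitz, hA3.consistent, fun τ Δx _ u w huw x => by
      simp only [schemeM, hind]; linarith [huw x]⟩
  obtain ⟨C, hC⟩ := exists_error_bound hA3' (ht.1.trans ht.2) hA1 hv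
    (fun τ Δx h => ⟨h.2, lt_of_lt_of_eq h.2 h.1⟩) zero_le_one (fun τ Δx h => by rw [one_mul]; exact h.1.le)
  -- The iterates of `S^M` are exactly v0 - nτ H(x, 0); refining the step identifies v with this
  -- formula.
  have key : ∀ N : ℕ, |v0 x - t * H x 0 - v t x| ≤ C * √(t / ((N : ℝ) + 1)) := by
    intro N
    have hN : (0 : ℝ) < N + 1 := by positivity
    have hNt : ((N + 1 : ℕ) : ℝ) * (t / ((N : ℝ) + 1)) = t := by push_cast; field_simp
    have := hC (t / ((N : ℝ) + 1)) (t / ((N : ℝ) + 1)) 0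
      (fun n x => v0 x - n * (t / ((N : ℝ) + 1)) * H x 0) ⟨rfl, by positivity⟩ le_rfl (by simp)
      (fun n x => by
        simp only [schemeM, hind, zero_mul]
        apply le_of_eq
        rw [abs_eq_zero]
        push_cast; ring) (N + 1) (by rw [hNt]; exact ht.2) x
    simp only [hNt] at this
    linarith
  have hlim : Filter.Tendsto (fun N : ℕ => C * √(t / ((N : ℝ) + 1))) Filter.atTop (nhds 0) := by
    have h1 : Filter.Tendsto (fun N : ℕ => t / ((N : ℝ) + 1)) Filter.atTop (nhds 0) := by
      have := (tendsto_one_div_add_atTop_nhds_zero_nat (𝕜 := ℝ)).const_mul t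
      simpa [div_eq_mul_inv] using this
    have h2 := (Real.continuous_sqrt.tendsto 0).comp h1
    simpa using h2.const_mul C
  have h2 : |v0 x - t * H x 0 - v t x| ≤ 0 := ge_of_tendsto' hlim key
  have h3 := abs_nonpos_iff.1 h2
  linarith

/-! ### Stability and first order consistency. -/

/-- Stability of perturbations of a monotone scheme. -/
theorem AssumptionA3.abs_sub_le_of_perturbation {H : ℝ → ℝ → ℝ} {hM : ℝ → ℝ → ℝ → ℝ}
    {G : Set (ℝ × ℝ)} (h : AssumptionA3 H hM G) {τ Δx T e e' : ℝ} (hG : (τ, Δx) ∈ G) (hτ : 0 ≤ τ)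
    {u w : ℕ → ℝ → ℝ} (h0 : u 0 = w 0)
    (hu : ∀ n x, |u (n + 1) x - schemeM hM τ Δx (u n) x| ≤ e * τ)
    (hw : ∀ n : ℕ, n * τ + τ ≤ T → ∀ x, |w (n + 1) x - schemeM hM τ Δx (w n) x| ≤ e' * τ)
    (n : ℕ) (hn : n * τ ≤ T) (x : ℝ) : |u n x - w n x| ≤ n * τ * (e + e') := by
  induction n generalizing x with
  | zero => simp [h0]
  | succ n ih =>
    have hn' : n * τ + τ ≤ T := by push_cast at hn; linarith
    have ih := ih (by linarith)
    -- A monotone scheme commuting with constants is nonexpansive in the sup norm, so the defects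
    -- merely add up.
    have h1 := h.monotone τ Δx hG (u n) (fun y => w n y + n * τ * (e + e'))
      (fun y => by linarith [(abs_le.1 (ih y)).2]) x
    have h2 := h.monotone τ Δx hG (w n) (fun y => u n y + n * τ * (e + e'))
      (fun y => by linarith [(abs_le.1 (ih y)).1]) x
    rw [schemeM_add_const] at h1 h2
    have h3 := abs_le.1 (hu n x)
    have h4 := abs_le.1 (hw n hn' x)
    push_cast
    rw [abs_le]
    constructor <;> linarith [h3.1, h3.2, h4.1, h4.2]

/-- The mean value inequality is applied first to f', then to f minus its linear part. The constant
M, instead of Taylor's M/2, suffices. -/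
theorem abs_sub_sub_deriv_le {f : ℝ → ℝ} {x y M : ℝ} (hf : ∀ s ∈ uIcc x y, ContDiffAt ℝ 2 f s)
    (hM : ∀ s ∈ uIcc x y, |iteratedDeriv 2 f s| ≤ M) :
    |f y - f x - (y - x) * deriv f x| ≤ M * (y - x) ^ 2 := by
  have hx : x ∈ uIcc x y := left_mem_uIcc
  have hM0 : 0 ≤ M := (abs_nonneg _).trans (hM x hx)
  have hd : ∀ s ∈ uIcc x y, DifferentiableAt ℝ (deriv f) s := fun s hs => by
    have h1 : deriv f = fun s => fderiv ℝ f s 1 := funext fun s => fderiv_apply_one_eq_deriv.symm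
    rw [h1]
    exact (((hf s hs).fderiv_right (m := 1) (by norm_num)).clm_apply
      contDiffAt_const).differentiableAt (by norm_num)
  have h1 : ∀ s ∈ uIcc x y, |deriv f s - deriv f x| ≤ M * |y - x| := fun s hs => by
    have := (convex_uIcc x y).norm_image_sub_le_of_norm_deriv_le (f := deriv f) (C := M) hd
      (fun z hz => by
        have := hM z hz
        rwa [iteratedDeriv_succ, iteratedDeriv_one] at this) hx hs
    refine this.trans (mul_le_mul_of_nonneg_left (abs_sub_left_of_mem_uIcc hs) hM0)
  have hfd : ∀ s ∈ uIcc x y, HasDerivAt (fun z => f z - z * deriv f x) (deriv f s - deriv f x) s :=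
    fun s hs => by
      have h2 := ((hf s hs).differentiableAt (by norm_num)).hasDerivAt
      simpa using h2.fun_sub ((hasDerivAt_id s).mul_const (deriv f x))
  have h2 := (convex_uIcc x y).norm_image_sub_le_of_norm_deriv_le
    (f := fun z => f z - z * deriv f x) (fun s hs => (hfd s hs).differentiableAt)
    (fun s hs => by rw [(hfd s hs).deriv]; exact h1 s hs) hx right_mem_uIcc
  have e1 : f y - y * deriv f x - (f x - x * deriv f x) = f y - f x - (y - x) * deriv f x := by ring
  simp only [e1, Real.norm_eq_abs, mul_assoc, abs_mul_abs_self] at h2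
  rw [sq]; exact h2

/-- First order consistency of `S^M`. -/
theorem consErr_schemeM_le {H : ℝ → ℝ → ℝ} {hM : ℝ → ℝ → ℝ → ℝ} {K : ℝ} (hK : 0 ≤ K)
    (hlip : ∀ x y p p' q q', |hM x p q - hM y p' q'| ≤ K * max |x - y| (max |p - p'| |q - q'|))
    (hcons : ∀ x p, hM x p p = H x p) {τ Δx t x M M' : ℝ} (hτ : 0 < τ) (hΔx : 0 < Δx)
    {w : ℝ → ℝ → ℝ} (hwt : ∀ s ∈ Icc t (t + τ), ContDiffAt ℝ 2 (fun s => w s x) s)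
    (hMt : ∀ s ∈ Icc t (t + τ), |iteratedDeriv 2 (fun s => w s x) s| ≤ M)
    (hwx : ∀ y ∈ Icc (x - Δx) (x + Δx), ContDiffAt ℝ 2 (fun y => w t y) y)
    (hMx : ∀ y ∈ Icc (x - Δx) (x + Δx), |iteratedDeriv 2 (fun y => w t y) y| ≤ M') :
    consErr H (schemeM hM τ Δx) τ w t x ≤ τ * M + K * (Δx * M') := by
  have ht := abs_sub_sub_deriv_le (f := fun s => w s x) (x := t) (y := t + τ)
    (by rwa [uIcc_of_le (by linarith)]) (by rwa [uIcc_of_le (by linarith)])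
  have hplus := abs_sub_sub_deriv_le (f := fun y => w t y) (x := x) (y := x + Δx)
    (by rw [uIcc_of_le (by linarith)]; exact fun s hs => hwx s ⟨by linarith [hs.1], hs.2⟩)
    (by rw [uIcc_of_le (by linarith)]; exact fun s hs => hMx s ⟨by linarith [hs.1], hs.2⟩)
  have hminus := abs_sub_sub_deriv_le (f := fun y => w t y) (x := x) (y := x - Δx)
    (by rw [uIcc_of_ge (by linarith)]; exact fun s hs => hwx s ⟨hs.1, by linarith [hs.2]⟩)
    (by rw [uIcc_of_ge (by linarith)]; exact fun s hs => hMx s ⟨hs.1, by linarith [hs.2]⟩)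
  change |w (t + τ) x - w t x - (t + τ - t) * dt w t x| ≤ _ at ht
  change |w t (x + Δx) - w t x - (x + Δx - x) * dx w t x| ≤ _ at hplus
  change |w t (x - Δx) - w t x - (x - Δx - x) * dx w t x| ≤ _ at hminus
  have h1 : |(w (t + τ) x - w t x) / τ - dt w t x| ≤ τ * M := by
    have e : (w (t + τ) x - w t x) / τ - dt w t x =
      (w (t + τ) x - w t x - (t + τ - t) * dt w t x) / τ := by field_simp; ring
    rw [e, abs_div, abs_of_pos hτ, div_le_iff₀ hτ]
    refine ht.trans (le_of_eq (by ring))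
  have h2 : |dPlus Δx 1 (w t) x - dx w t x| ≤ Δx * M' := by
    have e : dPlus Δx 1 (w t) x - dx w t x =
      (w t (x + Δx) - w t x - (x + Δx - x) * dx w t x) / Δx := by
      simp only [dPlus, Nat.cast_one, one_mul]; field_simp; ring
    rw [e, abs_div, abs_of_pos hΔx, div_le_iff₀ hΔx]
    refine hplus.trans (le_of_eq (by ring))
  have h3 : |dMinus Δx 1 (w t) x - dx w t x| ≤ Δx * M' := by
    have e : dMinus Δx 1 (w t) x - dx w t x =
      -(w t (x - Δx) - w t x - (x - Δx - x) * dx w t x) / Δx := by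
      simp only [dMinus, Nat.cast_one, one_mul]; field_simp; ring
    rw [e, abs_div, abs_neg, abs_of_pos hΔx, div_le_iff₀ hΔx]
    refine hminus.trans (le_of_eq (by ring))
  have h4 : |hM x (dMinus Δx 1 (w t) x) (dPlus Δx 1 (w t) x) - H x (dx w t x)| ≤
      K * (Δx * M') := by
    rw [← hcons]
    refine (hlip _ _ _ _ _ _).trans (mul_le_mul_of_nonneg_left ?_ hK)
    rw [sub_self, abs_zero]
    exact max_le ((abs_nonneg _).trans h2) (max_le h3 h2)
  have e : (w (t + τ) x - schemeM hM τ Δx (w t) x) / τ - (dt w t x + H x (dx w t x)) =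
      ((w (t + τ) x - w t x) / τ - dt w t x) +
        (hM x (dMinus Δx 1 (w t) x) (dPlus Δx 1 (w t) x) - H x (dx w t x)) := by
    simp only [schemeM]; field_simp; ring
  rw [consErr, e]
  exact (abs_add_le _ _).trans (add_le_add h1 h4)

/-- The second derivative of a `C²` function along a line. -/
theorem iteratedDeriv_two_comp_line {f : ℝ × ℝ → ℝ} {γ : ℝ → ℝ × ℝ} {e : ℝ × ℝ}
    (hγ : ∀ s, HasDerivAt γ e s) {s : ℝ} (hf : ContDiffAt ℝ 2 f (γ s)) :
    iteratedDeriv 2 (fun s => f (γ s)) s = fderiv ℝ (fun z => fderiv ℝ f z e) (γ s) e := by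
  have h1 : ∀ᶠ z in nhds (γ s), ContDiffAt ℝ 2 f z := hf.eventually (by simp)
  have h2 : deriv (fun s => f (γ s)) =ᶠ[nhds s] fun s => fderiv ℝ f (γ s) e := by
    filter_upwards [(hγ s).continuousAt.eventually h1] with r hr
    exact ((hr.differentiableAt (by norm_num)).hasFDerivAt.comp_hasDerivAt r (hγ r)).deriv
  have h3 : DifferentiableAt ℝ (fun z => fderiv ℝ f z e) (γ s) :=
    ((hf.fderiv_right (m := 1) (by norm_num)).clm_apply contDiffAt_const).differentiableAt
      (by norm_num)
  rw [iteratedDeriv_succ, iteratedDeriv_one, h2.deriv_eq]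
  exact (h3.hasFDerivAt.comp_hasDerivAt s (hγ s)).deriv

theorem continuousOn_fderiv_fderiv {f : ℝ × ℝ → ℝ} {s : Set (ℝ × ℝ)} (e : ℝ × ℝ)
    (hf : ∀ z ∈ s, ContDiffAt ℝ 2 f z) :
    ContinuousOn (fun z => fderiv ℝ (fun z => fderiv ℝ f z e) z e) s := fun z hz => by
  have h1 : ContDiffAt ℝ 1 (fun z => fderiv ℝ f z e) z :=
    ((hf z hz).fderiv_right (m := 1) (by norm_num)).clm_apply contDiffAt_const
  exact ((h1.fderiv_right (m := 0) (by norm_num)).clm_apply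
    contDiffAt_const).continuousAt.continuousWithinAt

/-- Since `sSup` of an unbounded set of reals is 0, boundedness has to be proved: joint C²
regularity makes the partial derivative continuous on the compact rectangle. -/
theorem abs_iteratedDeriv_le_normDt {w : ℝ → ℝ → ℝ} {a b c d : ℝ} (hw : SmoothOnRect 2 w a b c d)
    {t x : ℝ} (ht : t ∈ Icc a b) (hx : x ∈ Icc c d) :
    |iteratedDeriv 2 (fun s => w s x) t| ≤ normDt 2 w a b c d := by
  have h1 : ∀ z ∈ Icc a b ×ˢ Icc c d, iteratedDeriv 2 (fun s => w s z.2) z.1 =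
      fderiv ℝ (fun y => fderiv ℝ (fun z : ℝ × ℝ => w z.1 z.2) y (1, 0)) z (1, 0) := fun z hz =>
    iteratedDeriv_two_comp_line (f := fun z : ℝ × ℝ => w z.1 z.2) (γ := fun s => (s, z.2))
      (s := z.1) (fun s => (hasDerivAt_id s).prodMk (hasDerivAt_const s z.2)) (hw z hz)
  have h2 : ContinuousOn (fun z : ℝ × ℝ => |iteratedDeriv 2 (fun s => w s z.2) z.1|)
      (Icc a b ×ˢ Icc c d) := ((continuousOn_fderiv_fderiv (1, 0) hw).congr h1).abs
  exact le_csSup ((isCompact_Icc.prod isCompact_Icc).bddAbove_image h2) ⟨(t, x), ⟨ht, hx⟩, rfl⟩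

theorem abs_iteratedDeriv_le_normDx {w : ℝ → ℝ → ℝ} {a b c d : ℝ} (hw : SmoothOnRect 2 w a b c d)
    {t x : ℝ} (ht : t ∈ Icc a b) (hx : x ∈ Icc c d) :
    |iteratedDeriv 2 (fun y => w t y) x| ≤ normDx 2 w a b c d := by
  have h1 : ∀ z ∈ Icc a b ×ˢ Icc c d, iteratedDeriv 2 (fun y => w z.1 y) z.2 =
      fderiv ℝ (fun y => fderiv ℝ (fun z : ℝ × ℝ => w z.1 z.2) y (0, 1)) z (0, 1) := fun z hz =>
    iteratedDeriv_two_comp_line (f := fun z : ℝ × ℝ => w z.1 z.2) (γ := fun s => (z.1, s))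
      (s := z.2) (fun s => (hasDerivAt_const s z.1).prodMk (hasDerivAt_id s)) (hw z hz)
  have h2 : ContinuousOn (fun z : ℝ × ℝ => |iteratedDeriv 2 (fun y => w z.1 y) z.2|)
      (Icc a b ×ˢ Icc c d) := ((continuousOn_fderiv_fderiv (0, 1) hw).congr h1).abs
  exact le_csSup ((isCompact_Icc.prod isCompact_Icc).bddAbove_image h2) ⟨(t, x), ⟨ht, hx⟩, rfl⟩

theorem normDt_nonneg (m : ℕ) (w : ℝ → ℝ → ℝ) (a b c d : ℝ) : 0 ≤ normDt m w a b c d :=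
  Real.sSup_nonneg (by rintro _ ⟨z, -, rfl⟩; exact abs_nonneg _)

theorem normDx_nonneg (m : ℕ) (w : ℝ → ℝ → ℝ) (a b c d : ℝ) : 0 ≤ normDx m w a b c d :=
  Real.sSup_nonneg (by rintro _ ⟨z, -, rfl⟩; exact abs_nonneg _)

theorem AssumptionA3.exists_consistencyConst {H : ℝ → ℝ → ℝ} {hM : ℝ → ℝ → ℝ → ℝ}
    {G : Set (ℝ × ℝ)} (h : AssumptionA3 H hM G)
    (hG : ∀ τ Δx : ℝ, (τ, Δx) ∈ G → 0 < τ ∧ 0 < Δx) :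
    ∃ CM : ℝ, ∀ (w : ℝ → ℝ → ℝ) (a b c d : ℝ), SmoothOnRect 2 w a b c d →
      IsConsistencyConst H G (schemeM hM) 1 1 w a b c d CM := by
  obtain ⟨K, hK, hlip⟩ := h.exists_lipschitz
  refine ⟨1 + K, fun w a b c d hw => ⟨by positivity, ?_⟩⟩
  intro τ Δx t x hmem h1 h2 h3 h4
  obtain ⟨hτ, hΔx⟩ := hG _ _ hmem
  simp only [Nat.cast_one, one_mul] at h3 h4
  have ht : t ∈ Icc a b := ⟨h1, by linarith⟩
  have hx : x ∈ Icc c d := ⟨by linarith, by linarith⟩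
  have hI : ∀ s ∈ Icc t (t + τ), s ∈ Icc a b := fun s hs => ⟨h1.trans hs.1, hs.2.trans h2⟩
  have hJ : ∀ y ∈ Icc (x - Δx) (x + Δx), y ∈ Icc c d := fun y hy =>
    ⟨h3.trans hy.1, hy.2.trans h4⟩
  have key := consErr_schemeM_le hK hlip h.consistent hτ hΔx (w := w) (t := t) (x := x)
    (fun s hs => (hw (s, x) ⟨hI s hs, hx⟩).comp (f := fun s : ℝ => (s, x)) s (by fun_prop))
    (fun s hs => abs_iteratedDeriv_le_normDt hw (hI s hs) hx)
    (fun y hy => (hw (t, y) ⟨ht, hJ y hy⟩).comp (f := fun y : ℝ => (t, y)) y (by fun_prop))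
    (fun y hy => abs_iteratedDeriv_le_normDx hw ht (hJ y hy))
  refine key.trans ?_
  have i1 := mul_nonneg hτ.le (normDt_nonneg 2 w a b c d)
  have i2 := mul_nonneg hΔx.le (normDx_nonneg 2 w a b c d)
  have i3 := mul_nonneg hK i1
  simp only [pow_one, Nat.reduceAdd]
  linarith

/-- A viscosity solution satisfies the equation at the points near which it is `C¹`. -/
theorem IsViscositySolution.eq_zero {H : ℝ → ℝ → ℝ} {v0 : ℝ → ℝ} {T : ℝ} {v : ℝ → ℝ → ℝ}
    (hv : IsViscositySolution H v0 T v) {t x : ℝ} (ht : t ∈ Ioo 0 T)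
    (hC : ContDiffAt ℝ 1 (fun z : ℝ × ℝ => v z.1 z.2) (t, x)) :
    dt v t x + H x (dx v t x) = 0 :=
  -- v serves as its own test function: v - v is constant, hence both a local maximum and a local
  -- minimum.
  le_antisymm
    (hv.subsolution v t x ht hC (by simpa using isLocalMax_const))
    (hv.supersolution v t x ht hC (by simpa using isLocalMin_const))

/-- First order consistency of `S^M` for a `C²` solution, up to the boundary of the strip. -/
theorem IsViscositySolution.abs_sub_schemeM_le {H : ℝ → ℝ → ℝ} {hM : ℝ → ℝ → ℝ → ℝ}
    {G : Set (ℝ × ℝ)} (h : AssumptionA3 H hM G) {v0 : ℝ → ℝ} {T : ℝ} {v : ℝ → ℝ → ℝ} {K B : ℝ}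
    (hK : 0 ≤ K)
    (hlip : ∀ x y p p' q q', |hM x p q - hM y p' q'| ≤ K * max |x - y| (max |p - p'| |q - q'|))
    (hv : IsViscositySolution H v0 T v)
    (hC : ContDiffOn ℝ 2 (fun z : ℝ × ℝ => v z.1 z.2) (Icc 0 T ×ˢ univ))
    (hB : ∀ t ∈ Icc 0 T, ∀ x : ℝ, |iteratedDerivWithin 2 (fun s => v s x) (Icc 0 T) t| ≤ B ∧
      |iteratedDeriv 2 (fun y => v t y) x| ≤ B)
    {τ Δx t : ℝ} (ht : 0 ≤ t) (hτ : 0 < τ) (hΔx : 0 < Δx) (htT : t + τ ≤ T) (x : ℝ) :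
    |v (t + τ) x - schemeM hM τ Δx (v t) x| ≤ (τ * B + K * (Δx * B)) * τ := by
  have hB0 : 0 ≤ B := (abs_nonneg _).trans (hB t ⟨ht, by linarith⟩ 0).2
  have hat : ∀ t ∈ Ioo 0 T, ∀ x, ContDiffAt ℝ 2 (fun z : ℝ × ℝ => v z.1 z.2) (t, x) :=
    fun t ht x => hC.contDiffAt (prod_mem_nhds (Icc_mem_nhds ht.1 ht.2) Filter.univ_mem)
  -- the estimate inside the strip
  have inner : ∀ t τ : ℝ, 0 < t → 0 < τ → t + τ < T →
      |v (t + τ) x - schemeM hM τ Δx (v t) x| ≤ (τ * B + K * (Δx * B)) * τ := by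
    intro t τ ht hτ htT
    have hI : ∀ s ∈ Icc t (t + τ), s ∈ Ioo 0 T := fun s hs =>
      ⟨ht.trans_le hs.1, hs.2.trans_lt htT⟩
    have ht' : t ∈ Ioo 0 T := ⟨ht, by linarith⟩
    have hcd : ∀ s ∈ Icc t (t + τ), ContDiffAt ℝ 2 (fun s => v s x) s := fun s hs =>
      (hat s (hI s hs) x).comp (f := fun s : ℝ => (s, x)) s (by fun_prop)
    have key := consErr_schemeM_le hK hlip h.consistent hτ hΔx (w := v) (t := t) (x := x)
      (M := B) (M' := B) hcd
      (fun s hs => by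
        have := (hB s (Ioo_subset_Icc_self (hI s hs)) x).1
        rwa [iteratedDerivWithin_eq_iteratedDeriv
          (uniqueDiffOn_Icc (by linarith)) (hcd s hs) (Ioo_subset_Icc_self (hI s hs))] at this)
      (fun y _ => (hat t ht' y).comp (f := fun y : ℝ => (t, y)) y (by fun_prop))
      (fun y _ => (hB t (Ioo_subset_Icc_self ht') y).2)
    rwa [consErr, hv.eq_zero ht' ((hat t ht' x).of_le (by norm_num)), sub_zero, abs_div,
      abs_of_pos hτ, div_le_iff₀ hτ] at key
  have hmaps : ∀ (c : ℝ), c ∈ Icc t (t + τ) → c ∈ Icc 0 T := fun c hc =>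
    ⟨ht.trans hc.1, hc.2.trans htT⟩
  have hvc : ∀ (g : ℝ → ℝ), Continuous g → (∀ s ∈ Icc (0 : ℝ) (1 / 2), g s ∈ Icc t (t + τ)) →
      ∀ y, ContinuousOn (fun s => v (g s) y) (Icc (0 : ℝ) (1 / 2)) := fun g hg hgm y =>
    hv.continuousOn.comp (f := fun s : ℝ => (g s, y)) (by fun_prop)
      (fun s hs => ⟨hmaps _ (hgm s hs), mem_univ _⟩)
  have hv1 := hvc (fun s => t + s * τ) (by fun_prop)
    (fun s hs => ⟨by nlinarith [hs.1], by nlinarith [hs.2]⟩)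
  have hv2 := hvc (fun s => t + s * τ + τ * (1 - 2 * s)) (by fun_prop)
    (fun s hs => ⟨by nlinarith [hs.2], by nlinarith [hs.1]⟩)
  have hhM : Continuous (fun z : ℝ × ℝ × ℝ => hM z.1 z.2.1 z.2.2) := by
    obtain ⟨K', hK'⟩ := h.lipschitz
    exact hK'.continuous
  have hcl : closure (Ioo (0 : ℝ) (1 / 2)) = Icc 0 (1 / 2) := closure_Ioo (by norm_num)
  -- The equation is known only at interior times. The interval is shrunk to [t + sτ, t + τ - sτ]
  -- and s tends to 0; only continuity of v and h^M is needed in the limit.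
  have := le_on_closure (s := Ioo (0 : ℝ) (1 / 2)) (x := 0)
    (f := fun s => |v (t + s * τ + τ * (1 - 2 * s)) x -
      schemeM hM (τ * (1 - 2 * s)) Δx (v (t + s * τ)) x|)
    (g := fun s => (τ * (1 - 2 * s) * B + K * (Δx * B)) * (τ * (1 - 2 * s)))
    (fun s hs => inner _ _ (by nlinarith [hs.1]) (mul_pos hτ (by linarith [hs.2]))
      (by nlinarith [hs.1]))
    (by
      rw [hcl]
      refine ((hv2 x).sub ((hv1 x).sub (ContinuousOn.mul (by fun_prop) ?_))).abs
      refine hhM.comp_continuousOn (f := fun s => (x, dMinus Δx 1 (v (t + s * τ)) x,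
        dPlus Δx 1 (v (t + s * τ)) x)) (continuousOn_const.prodMk (ContinuousOn.prodMk ?_ ?_))
      · exact (((hv1 _).sub (hv1 x)).div_const Δx).neg
      · exact ((hv1 _).sub (hv1 x)).div_const Δx)
    (by fun_prop) (by rw [hcl]; exact ⟨le_rfl, by norm_num⟩)
  simpa using this

/-! ### The filtered scheme. -/

theorem abs_filteredSol_sub_schemeM_le {r : ℕ} (hM : ℝ → ℝ → ℝ → ℝ)
    (hA : ℝ → ℝ → ℝ → (Fin r → ℝ) → (Fin r → ℝ) → ℝ) {F : ℝ → ℝ} (hF : ∀ y, |F y| ≤ 1)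
    {ε τ : ℝ} (hε : 0 ≤ ε) (hτ : 0 ≤ τ) (Δx : ℝ) (v0 : ℝ → ℝ) (n : ℕ) (x : ℝ) :
    |filteredSol hM hA F ε τ Δx v0 (n + 1) x -
      schemeM hM τ Δx (filteredSol hM hA F ε τ Δx v0 n) x| ≤ ε * τ := by
  simp only [filteredSol, schemeF, add_sub_cancel_left, abs_mul, abs_of_nonneg hε,
    abs_of_nonneg hτ]
  exact mul_le_of_le_one_right (mul_nonneg hε hτ) (hF _)

/-- The error of the filtered scheme when the numerical Hamiltonian does not depend on the
gradient: `S^M` is then exact. -/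
theorem abs_filteredSol_sub_le_of_indep {H : ℝ → ℝ → ℝ} {hM : ℝ → ℝ → ℝ → ℝ} {G : Set (ℝ × ℝ)}
    (hA3 : AssumptionA3 H hM G) (hind : ∀ x p q, hM x p q = H x 0) {T : ℝ} {v0 : ℝ → ℝ}
    {v : ℝ → ℝ → ℝ} (hA1 : AssumptionA1 v0) (hv : IsViscositySolution H v0 T v)
    {r : ℕ} (hA : ℝ → ℝ → ℝ → (Fin r → ℝ) → (Fin r → ℝ) → ℝ) {F : ℝ → ℝ} (hF : ∀ y, |F y| ≤ 1)
    {ε τ Δx : ℝ} (hG : (τ, Δx) ∈ G) (hε : 0 ≤ ε) (hτ : 0 ≤ τ) (n : ℕ) (hn : n * τ ≤ T) (x : ℝ) :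
    |filteredSol hM hA F ε τ Δx v0 n x - v (n * τ) x| ≤ T * ε := by
  have := hA3.abs_sub_le_of_perturbation (e' := 0) (T := T) hG hτ
    (u := filteredSol hM hA F ε τ Δx v0) (w := fun n x => v (n * τ) x)
    (by funext x; simp [filteredSol, hv.initial])
    (abs_filteredSol_sub_schemeM_le hM hA hF hε hτ Δx v0)
    (fun n hn x => by
      have h0 : 0 ≤ n * τ := by positivity
      simp only [schemeM, hind]
      rw [eq_sub_mul_of_indep hA3 hind hA1 hv (t := n * τ) ⟨h0, by linarith⟩,
        eq_sub_mul_of_indep hA3 hind hA1 hv ⟨by positivity, by push_cast; linarith⟩]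
      apply le_of_eq
      rw [zero_mul, abs_eq_zero]
      push_cast; ring) n hn x
  rw [add_zero] at this
  exact this.trans (mul_le_mul_of_nonneg_right hn hε)

/-- Where both schemes are consistent within `ε`, the filter is inactive. -/
theorem schemeF_eq_schemeA {r : ℕ} {H : ℝ → ℝ → ℝ} {hM : ℝ → ℝ → ℝ → ℝ}
    {hA : ℝ → ℝ → ℝ → (Fin r → ℝ) → (Fin r → ℝ) → ℝ} {F : ℝ → ℝ} (hF : ∀ y, |y| ≤ 1 → F y = y)
    {ε τ Δx t x : ℝ} {w : ℝ → ℝ → ℝ} (hε : 0 < ε) (hτ : 0 < τ)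
    (h : consErr H (schemeA hA τ Δx) τ w t x + consErr H (schemeM hM τ Δx) τ w t x ≤ ε) :
    schemeF hM hA F ε τ Δx (w t) x = schemeA hA τ Δx (w t) x := by
  have hετ : 0 < ε * τ := mul_pos hε hτ
  simp only [consErr] at h
  set D := dt w t x + H x (dx w t x)
  set a := schemeA hA τ Δx (w t) x with ha
  set m := schemeM hM τ Δx (w t) x with hm
  have h1 : |(a - m) / τ| ≤ ε := by
    -- The two consistency errors share the time increment of w and the value D, and both cancel.
    have e : (a - m) / τ = ((w (t + τ) x - m) / τ - D) - ((w (t + τ) x - a) / τ - D) := by ring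
    rw [e]
    exact (abs_sub _ _).trans (by linarith)
  have h2 : |(a - m) / (ε * τ)| ≤ 1 := by
    rw [abs_div, abs_of_pos hτ, div_le_iff₀ hτ] at h1
    rw [abs_div, abs_of_pos hετ]
    exact div_le_one_of_le₀ h1 hετ.le
  rw [schemeF, ← ha, ← hm, hF _ h2, mul_div_cancel₀ _ hετ.ne']
  ring

/-- Here v is affine in time, so the τ^ℓ term in the consistency bound disappears in the one case
where no CFL condition is available. -/
theorem normDt_eq_zero_of_indep {H : ℝ → ℝ → ℝ} {hM : ℝ → ℝ → ℝ → ℝ} {G : Set (ℝ × ℝ)}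
    (hA3 : AssumptionA3 H hM G) (hind : ∀ x p q, hM x p q = H x 0) {T : ℝ} {v0 : ℝ → ℝ}
    {v : ℝ → ℝ → ℝ} (hA1 : AssumptionA1 v0) (hv : IsViscositySolution H v0 T v) {ℓ : ℕ}
    (hℓ : 1 ≤ ℓ) {a b : ℝ} (ha : 0 < a) (hb : b < T) (c d : ℝ) :
    normDt (ℓ + 1) v a b c d = 0 := by
  refine le_antisymm (Real.sSup_nonpos ?_) (normDt_nonneg _ _ _ _ _ _)
  rintro _ ⟨z, hz, rfl⟩
  have h1 : (fun s => v s z.2) =ᶠ[nhds z.1] fun s => v0 z.2 - s * H z.2 0 := by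
    filter_upwards [Icc_mem_nhds (ha.trans_le hz.1.1) (hz.1.2.trans_lt hb)] with s hs
    exact eq_sub_mul_of_indep hA3 hind hA1 hv hs z.2
  have h2 : deriv (fun s => v0 z.2 - s * H z.2 0) = fun _ => -H z.2 0 := by
    funext s
    simp
  simp only [h1.iteratedDeriv_eq, iteratedDeriv_succ', h2]
  -- One derivative has been used to reach a constant; ℓ ≥ 1 leaves at least one more.
  rw [iteratedDeriv_const, if_neg (by lia), abs_zero]

end FilteredHJ

/-! ### Proof of the theorem. -/

open FilteredHJ in
theorem theorem1
    (H : ℝ → ℝ → ℝ) (v0 : ℝ → ℝ) (T : ℝ) (hT : 0 < T)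
    (hA1 : AssumptionA1 v0) (hA2 : AssumptionA2 H)
    (hv0 : ∃ B : ℝ, ∀ x, |v0 x| ≤ B)
    (v : ℝ → ℝ → ℝ) (hv : IsViscositySolution H v0 T v)
    (hM : ℝ → ℝ → ℝ → ℝ)
    (G : Set (ℝ × ℝ)) (hG : ∀ τ Δx : ℝ, (τ, Δx) ∈ G → 0 < τ ∧ 0 < Δx)
    (hA3 : AssumptionA3 H hM G) :
    -- (i)
    (∀ c0 : ℝ, 0 < c0 → ∃ C : ℝ,
      ∀ (r : ℕ) (hA : ℝ → ℝ → ℝ → (Fin r → ℝ) → (Fin r → ℝ) → ℝ)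
        (F : ℝ → ℝ), (∀ y, |F y| ≤ 1) →
      ∀ (N : ℕ) (Δx ε : ℝ), 1 ≤ N → (T / N, Δx) ∈ G → 0 < ε → ε ≤ c0 * √Δx →
      ∀ n : ℕ, n ≤ N → ∀ j : ℤ,
        |filteredSol hM hA F ε (T / N) Δx v0 n (j * Δx) - v (n * (T / N)) (j * Δx)|
          ≤ C * √Δx) ∧
    -- (ii)
    (ContDiffOn ℝ 2 (fun z : ℝ × ℝ => v z.1 z.2) (Set.Icc 0 T ×ˢ Set.univ) →
      (∃ B : ℝ, ∀ t ∈ Set.Icc 0 T, ∀ x : ℝ,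
        |iteratedDerivWithin 2 (fun s => v s x) (Set.Icc 0 T) t| ≤ B ∧
        |iteratedDeriv 2 (fun y => v t y) x| ≤ B) →
      ∀ c0 : ℝ, 0 < c0 → ∃ C : ℝ,
      ∀ (r : ℕ) (hA : ℝ → ℝ → ℝ → (Fin r → ℝ) → (Fin r → ℝ) → ℝ)
        (F : ℝ → ℝ), (∀ y, |F y| ≤ 1) →
      ∀ (N : ℕ) (Δx ε : ℝ), 1 ≤ N → (T / N, Δx) ∈ G → 0 < ε → ε ≤ c0 * Δx →
      ∀ n : ℕ, n ≤ N → ∀ j : ℤ,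
        |filteredSol hM hA F ε (T / N) Δx v0 n (j * Δx) - v (n * (T / N)) (j * Δx)|
          ≤ C * Δx) ∧
    -- a constant `C_M` exists, the same for all functions of class `C²` and all rectangles
    (∃ CM : ℝ, ∀ (w : ℝ → ℝ → ℝ) (a b c d : ℝ), a < b → c < d → SmoothOnRect 2 w a b c d →
      IsConsistencyConst H G (schemeM hM) 1 1 w a b c d CM) ∧
    -- (iii)
    (∀ (r : ℕ) (hA : ℝ → ℝ → ℝ → (Fin r → ℝ) → (Fin r → ℝ) → ℝ) (k : ℕ), 2 ≤ k →
      AssumptionA4 H hA G k →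
      ∀ ℓ : ℕ, 1 ≤ ℓ → ℓ ≤ k →
      ∀ t x a b c d : ℝ, 0 < a → a < t → t < b → b < T → c < x → x < d →
      SmoothOnRect (ℓ + 1) v a b c d →
      ∃ δ : ℝ, 0 < δ ∧ ∃ C : ℝ,
      ∀ CA CM : ℝ, IsConsistencyConst H G (schemeA hA) r 1 v a b c d CA →
        IsConsistencyConst H G (schemeM hM) 1 1 v a b c d CM →
      ∀ F : ℝ → ℝ, (∀ y, |y| ≤ 1 → F y = y) →
      ∀ (N : ℕ) (Δx ε : ℝ), 1 ≤ N → (T / N, Δx) ∈ G → 0 < ε →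
        (CA + CM) * (normDt 2 v a b c d * (T / N) + normDx 2 v a b c d * Δx) ≤ ε →
        T / N < δ → Δx < δ →
      ∀ (n : ℕ) (j : ℤ), |n * (T / N) - t| < δ → |j * Δx - x| < δ →
        schemeF hM hA F ε (T / N) Δx (v (n * (T / N))) (j * Δx) =
          schemeA hA (T / N) Δx (v (n * (T / N))) (j * Δx) ∧
        consErr H (schemeF hM hA F ε (T / N) Δx) (T / N) v (n * (T / N)) (j * Δx) =
          consErr H (schemeA hA (T / N) Δx) (T / N) v (n * (T / N)) (j * Δx) ∧
        consErr H (schemeA hA (T / N) Δx) (T / N) v (n * (T / N)) (j * Δx) ≤ C * Δx ^ ℓ) := by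
  have hn : ∀ N n : ℕ, 1 ≤ N → n ≤ N → n * (T / N) ≤ T := fun N n hN hnN => by
    have h1 : (0 : ℝ) < N := by exact_mod_cast hN
    have h2 : (n : ℝ) ≤ N := by exact_mod_cast hnN
    rw [mul_div_assoc', div_le_iff₀ h1, mul_comm T]
    exact mul_le_mul_of_nonneg_right h2 hT.le
  have hcase := hA3.indep_or_exists_cfl hG
  refine ⟨?_, ?_, ?_, ?_⟩
  · intro c0 hc0
    rcases hcase with hind | ⟨lam, hlam, hGlam⟩
    · refine ⟨T * c0, fun r hA F hF N Δx ε hN hmem hε hεc n hnN j => ?_⟩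
      refine (abs_filteredSol_sub_le_of_indep hA3 hind hA1 hv hA hF hmem hε.le (hG _ _ hmem).1.le n
        (hn N n hN hnN) _).trans ?_
      rw [mul_assoc]
      exact mul_le_mul_of_nonneg_left hεc hT.le
    · obtain ⟨C, hC⟩ := exists_error_bound hA3 hT.le hA1 hv hG hlam hGlam
      refine ⟨C + T * c0, fun r hA F hF N Δx ε hN hmem hε hεc n hnN j => ?_⟩
      refine (hC _ _ ε (filteredSol hM hA F ε (T / N) Δx v0) hmem hε.le rfl
        (abs_filteredSol_sub_schemeM_le hM hA hF hε.le (hG _ _ hmem).1.le Δx v0) n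
        (hn N n hN hnN) _).trans ?_
      have := mul_le_mul_of_nonneg_left hεc hT.le
      linarith
  · rintro hC2 ⟨B, hB⟩ c0 hc0
    rcases hcase with hind | ⟨lam, hlam, hGlam⟩
    · refine ⟨T * c0, fun r hA F hF N Δx ε hN hmem hε hεc n hnN j => ?_⟩
      refine (abs_filteredSol_sub_le_of_indep hA3 hind hA1 hv hA hF hmem hε.le (hG _ _ hmem).1.le n
        (hn N n hN hnN) _).trans ?_
      rw [mul_assoc]
      exact mul_le_mul_of_nonneg_left hεc hT.le
    · obtain ⟨K, hK, hlip⟩ := hA3.exists_lipschitz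
      have hB0 : 0 ≤ B := (abs_nonneg _).trans (hB 0 ⟨le_rfl, hT.le⟩ 0).2
      -- The defects per unit time are ε ≤ c0 Δx from the filter and τB + KΔxB from consistency,
      -- with τ ≤ λΔx; they accumulate over time T.
      refine ⟨T * (c0 + (lam * B + K * B)), fun r hA F hF N Δx ε hN hmem hε hεc n hnN j => ?_⟩
      obtain ⟨hτ, hΔx⟩ := hG _ _ hmem
      have key := hA3.abs_sub_le_of_perturbation (e := ε)
        (e' := T / N * B + K * (Δx * B)) (T := T) hmem hτ.le
        (u := filteredSol hM hA F ε (T / N) Δx v0) (w := fun n x => v (n * (T / N)) x)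
        (by funext x; simp [filteredSol, hv.initial])
        (abs_filteredSol_sub_schemeM_le hM hA hF hε.le hτ.le Δx v0)
        (fun n hn x => by
          have := hv.abs_sub_schemeM_le hA3 hK hlip hC2 hB (by positivity) hτ hΔx hn x
          rw [Nat.cast_succ, add_one_mul]
          exact this) n (hn N n hN hnN) (j * Δx)
      have h1 : T / N * B ≤ lam * Δx * B := mul_le_mul_of_nonneg_right (hGlam _ _ hmem) hB0
      refine key.trans ((mul_le_mul (hn N n hN hnN) (?_ : _ ≤ (c0 + (lam * B + K * B)) * Δx)
        (by positivity) hT.le).trans (mul_assoc _ _ _).ge)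
      linarith
  · obtain ⟨CM, hCM⟩ := hA3.exists_consistencyConst hG
    exact ⟨CM, fun w a b c d _ _ hw => hCM w a b c d hw⟩
  · intro r hA k _ hA4 ℓ hℓ hℓk t x a b c d ha hat htb hbT hcx hxd hsm
    have hpde : ∀ t ∈ Icc a b, ∀ x ∈ Icc c d, dt v t x + H x (dx v t x) = 0 := fun t ht x hx =>
      hv.eq_zero ⟨ha.trans_le ht.1, ht.2.trans_lt hbT⟩
        ((hsm (t, x) ⟨ht, hx⟩).of_le (by exact_mod_cast Nat.le_add_left 1 ℓ))
    obtain ⟨C, hC0, hC⟩ := hA4.consistent ℓ hℓ hℓk v a b c d (hat.trans htb) (hcx.trans hxd) hsm hpde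
    -- Both branches of the dichotomy turn the temporal error into a multiple of Δx^ℓ.
    obtain ⟨D, hD⟩ : ∃ D : ℝ, ∀ τ Δx : ℝ, (τ, Δx) ∈ G →
        τ ^ ℓ * normDt (ℓ + 1) v a b c d ≤ D * Δx ^ ℓ := by
      rcases hcase with hind | ⟨lam, hlam, hGlam⟩
      · exact ⟨0, fun τ Δx _ => by
          rw [normDt_eq_zero_of_indep hA3 hind hA1 hv hℓ ha hbT, mul_zero, zero_mul]⟩
      · refine ⟨lam ^ ℓ * normDt (ℓ + 1) v a b c d, fun τ Δx hmem => ?_⟩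
        rw [mul_right_comm, ← mul_pow]
        exact mul_le_mul_of_nonneg_right (pow_le_pow_left₀ (hG _ _ hmem).1.le (hGlam _ _ hmem) ℓ)
          (normDt_nonneg _ _ _ _ _ _)
    have hr : (0 : ℝ) < r + 2 := by positivity
    set m := min (min (t - a) (b - t)) (min (x - c) (d - x)) with hm
    have hm0 : 0 < m := lt_min (lt_min (by linarith) (by linarith))
      (lt_min (by linarith) (by linarith))
    have hm1 : m ≤ t - a := (min_le_left _ _).trans (min_le_left _ _)
    have hm2 : m ≤ b - t := (min_le_left _ _).trans (min_le_right _ _)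
    have hm3 : m ≤ x - c := (min_le_right _ _).trans (min_le_left _ _)
    have hm4 : m ≤ d - x := (min_le_right _ _).trans (min_le_right _ _)
    -- The distance m to the boundary of the rectangle must exceed the node offset plus rΔx for
    -- `S^A`, plus Δx for `S^M`, and plus τ in time. The divisor r + 2 covers all three, even for r
    -- = 0.
    refine ⟨m / (r + 2), by positivity, C * (D + normDx (ℓ + 1) v a b c d), ?_⟩
    intro CA CM hCA hCM F hF N Δx ε hN hmem hε hle hτδ hΔxδ n j hnt hjx
    obtain ⟨hτ, hΔx⟩ := hG _ _ hmem
    set δ := m / (r + 2) with hδ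
    have hδ0 : 0 < δ := by positivity
    have hδm : (r + 2) * δ = m := by rw [hδ]; field_simp
    have hrδ : 0 ≤ r * δ := by positivity
    have hrΔx : r * Δx ≤ r * δ := mul_le_mul_of_nonneg_left hΔxδ.le (Nat.cast_nonneg r)
    rw [abs_lt] at hnt hjx
    have i1 : a ≤ n * (T / N) := by linarith
    have i2 : n * (T / N) + T / N ≤ b := by linarith
    have i3 : c ≤ j * Δx - r * Δx := by linarith
    have i4 : j * Δx + r * Δx ≤ d := by linarith
    have i5 : c ≤ j * Δx - (1 : ℕ) * Δx := by rw [Nat.cast_one]; linarith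
    have i6 : j * Δx + (1 : ℕ) * Δx ≤ d := by rw [Nat.cast_one]; linarith
    have j1 := hCA.2 _ _ _ _ hmem i1 i2 i3 i4
    have j2 := hCM.2 _ _ _ _ hmem i1 i2 i5 i6
    have j3 := hC _ _ _ _ hmem i1 i2 i3 i4
    have hFA : schemeF hM hA F ε (T / N) Δx (v (n * (T / N))) (j * Δx) =
        schemeA hA (T / N) Δx (v (n * (T / N))) (j * Δx) := by
      refine schemeF_eq_schemeA hF (t := n * (T / N)) hε hτ ((add_le_add j1 j2).trans ?_)
      refine le_trans (le_of_eq ?_) hle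
      rw [pow_one, pow_one]; ring
    refine ⟨hFA, by rw [consErr, consErr, hFA], j3.trans ?_⟩
    rw [mul_assoc, add_mul, mul_comm (normDx _ _ _ _ _ _)]
    exact mul_le_mul_of_nonneg_left (add_le_add_left (hD _ _ hmem) _) hC0
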